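/- Let $n,m\ge 1$, $0<\alpha<n$, $0<\beta<m$ and $1<p<q<\infty$ satisfy $$\frac{\alpha}{n}=\frac{\beta}{m}=\frac1p-\frac1q .$$ Throughout, $Q\subset\mathbb R^n$ and $P\subset\mathbb R^m$ denote arbitrary cubes with sides parallel to the axes and positive side lengths. For functions $f$ on $\mathbb R^n\times\mathbb R^m$ define the strong fractional integral $$I_{\alpha\beta}f(x,y)=\iint_{\mathbb R^n\times\mathbb R^m} f(u,v)\,|x-u|^{\alpha-n}\,|y-v|^{\beta-m}\,du\,dv ,$$ and for $g\ge 0$ the strong maximal function $$Mg(x,y)=\sup_{Q\times P\ni (x,y)}\frac1{|Q||P|}\iint_{Q\times P} g .$$ A weight $w$ on $\mathbb R^n\times\mathbb R^m$ (measurable, $0<w<\infty$ a.e.) belongs to $A_p\times A_p$ if $$[w]_{A_p\times A_p}=\sup_{Q\times P}\left(\frac1{|Q||P|}\iint_{Q\times P} w\right)\left(\frac1{|Q||P|}\iint_{Q\times P} w^{-\frac1{p-1}}\right)^{p-1}<\infty .$$ For non-negative measurable $\omega,\sigma$ put $$A^{M}_{pq}(\omega,\sigma)=\sup_{Q\times P}\left\{\frac1{|Q||P|}\iint_{Q\times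 P}\omega^q\right\}^{\frac1q}\left\{\frac1{|Q||P|}\iint_{Q\times P} M\!\left(\sigma^{-\frac p{p-1}}\right)\right\}^{\frac{p-1}p}\in[0,\infty].$$ Then for every $K<\infty$ there is a finite constant $C$, depending only on $p,q,n,m$ and $K$, such that for all non-negative measurable $\omega,\sigma$ on $\mathbb R^n\times\mathbb R^m$ with $\sigma^p\in A_p\times A_p$ and $[\sigma^p]_{A_p\times A_p}\le K$, and all measurable $f:\mathbb R^n\times\mathbb R^m\to\mathbb C$, $$\|\omega\, I_{\alpha\beta}f\|_{L^q(\mathbb R^n\times\mathbb R^m)}\le C\,A^{M}_{pq}(\omega,\sigma)\,\|f\sigma\|_{L^p(\mathbb R^n\times\mathbb R^m)} .$$ In particular, if $A^M_{pq}(\omega,\sigma)<\infty$ and $\|f\sigma\|_{L^p}<\infty$, the integral defining $I_{\alpha\beta}f(x,y)$ converges absolutely for almost every $(x,y)$ with $\omega(x,y)\ne0$. (Products in $[0,\infty]$ use $0\cdot\infty=0$.) -/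

import Mathlib

open MeasureTheory
open scoped ENNReal NNReal

noncomputable section

/-- The product space `ℝⁿ × ℝᵐ`; each factor carries its Euclidean norm, and `volume` on the
product is Lebesgue measure. -/
abbrev ProdSpace (n m : ℕ) : Type :=
  EuclideanSpace ℝ (Fin n) × EuclideanSpace ℝ (Fin m)

/-- The closed cube in `ℝᵏ` with centre `c`, side length `2 * r` and sides parallel to the axes. -/
def cube {k : ℕ} (c : EuclideanSpace ℝ (Fin k)) (r : ℝ) : Set (EuclideanSpace ℝ (Fin k)) :=
  {x | ∀ i, |x i - c i| ≤ r}

/-- The rectangles `Q × P`, with `Q ⊆ ℝⁿ` and `P ⊆ ℝᵐ` nondegenerate cubes of arbitrary,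
unrelated side lengths. -/
def IsRectangle {n m : ℕ} (R : Set (ProdSpace n m)) : Prop :=
  ∃ (c : EuclideanSpace ℝ (Fin n)) (r : ℝ) (d : EuclideanSpace ℝ (Fin m)) (s : ℝ),
    0 < r ∧ 0 < s ∧ R = cube c r ×ˢ cube d s

/-- The average of `g` over `R`. -/
def setAvg {n m : ℕ} (R : Set (ProdSpace n m)) (g : ProdSpace n m → ℝ≥0∞) : ℝ≥0∞ :=
  (volume R)⁻¹ * ∫⁻ w in R, g w

/-- The two-parameter strong maximal function: the supremum of the averages of `g` over all
rectangles `Q × P` that contain the point `z`. -/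
def strongMaximal {n m : ℕ} (g : ProdSpace n m → ℝ≥0∞) (z : ProdSpace n m) : ℝ≥0∞ :=
  ⨆ (R : Set (ProdSpace n m)) (_ : IsRectangle R) (_ : z ∈ R), setAvg R g

/-- The `A_p × A_p` characteristic of `w`: the supremum over all rectangles `R = Q × P` of
`(⨍_R w) * (⨍_R w ^ (-1 / (p - 1))) ^ (p - 1)`. -/
def productApChar {n m : ℕ} (p : ℝ) (w : ProdSpace n m → ℝ≥0∞) : ℝ≥0∞ :=
  ⨆ (R : Set (ProdSpace n m)) (_ : IsRectangle R),
    setAvg R w * (setAvg R fun z => w z ^ (-1 / (p - 1))) ^ (p - 1)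

/-- The product Muckenhoupt class `A_p × A_p` of weights on `ℝⁿ × ℝᵐ`. -/
structure IsProductAp {n m : ℕ} (p : ℝ) (w : ProdSpace n m → ℝ≥0∞) : Prop where
  aemeasurable : AEMeasurable w volume
  ae_pos : ∀ᵐ z, 0 < w z
  ae_lt_top : ∀ᵐ z, w z < ∞
  char_lt_top : productApChar p w < ∞

/-- The variant `A^M_{pq}(ω, σ)` of the Muckenhoupt characteristic, in which
`(1 / σ) ^ (p / (p - 1))` is replaced by its strong maximal function. -/
def muckenhouptMaximalChar {n m : ℕ} (p q : ℝ) (ω σ : ProdSpace n m → ℝ≥0∞) : ℝ≥0∞ :=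
  ⨆ (R : Set (ProdSpace n m)) (_ : IsRectangle R),
    (setAvg R fun z => ω z ^ q) ^ (1 / q) *
      (setAvg R (strongMaximal fun w => (1 / σ w) ^ (p / (p - 1)))) ^ ((p - 1) / p)

/-- The kernel `(1 / |x - u|) ^ (n - α) * (1 / |y - v|) ^ (m - β)` at `z = (x, y)`, `w = (u, v)`. -/
def strongKernel {n m : ℕ} (α β : ℝ) (z w : ProdSpace n m) : ℝ :=
  (1 / ‖z.1 - w.1‖) ^ ((n : ℝ) - α) * (1 / ‖z.2 - w.2‖) ^ ((m : ℝ) - β)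

/-- The strong fractional integral `I_{αβ} f`. -/
def strongFractionalIntegral {n m : ℕ} (α β : ℝ) (f : ProdSpace n m → ℂ)
    (z : ProdSpace n m) : ℂ :=
  ∫ w, strongKernel α β z w • f w

end

/-!
The kernel of `I_{αβ}` is dominated by a sum over dyadic side lengths `2 ^ (i + 1)`, `2 ^ (j + 1)`,
so that `I_{αβ} |f| (z)` is at most a constant times
`∑ᵢ ∑ⱼ 2 ^ (α i + β j) ⨍_{R i j z} |f|`, with `R i j z` the dyadic rectangle centred at `z`
(`lintegral_strongKernel_le`). Put `v = σ ^ (-p / (p - 1))` and `g = |f| σ`, so that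
`|f| = g v ^ ((p - 1) / p)`, and write `A` for `A^M_{pq}(ω, σ)`. Three facts finish the proof.

*The dual weight satisfies a reverse Hölder inequality* `⨍_R v ^ (1 + ε) ≤ F (⨍_R v) ^ (1 + ε)` on
all rectangles (`exists_reverseHolder`). Bisecting all sides of a rectangle produces rectangles of
the same class, so the classical one-parameter argument runs inside each of them: by
`setLIntegral_le_of_muckenhoupt`, a subset of at most half the measure of a rectangle carries at
most a fixed fraction of its `v`-mass, and stopping once at twice the mean value of `v` lets a bound
for `k` generations reproduce itself for `k + 1` (`treeEnergy_le`); differentiation along the tree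
passes to the limit. With Hölder's inequality this gives, for some `1 < s < p`,
`⨍_R |f| ≤ F' (⨍_R v) ^ ((p - 1) / p) (⨍_R g ^ s) ^ (1 / s)`.

*The weight `ω` absorbs the averages of `v`.* Every point of `S = R i j z` satisfies
`M v ≥ ⨍_S v`. Applying the characteristic to rectangles that shrink to `z` inside `S` and
differentiating `ω ^ q` yields `ω z (⨍_S v) ^ ((p - 1) / p) ≤ A` for almost every `z` and all
`i`, `j` (`ae_mul_setAvg_rpow_le`). This is where the maximal function in the characteristic
matters. No multi-parameter maximal theorem is needed.

*The remaining unweighted operator is bounded.* It is left to bound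
`∑ᵢ ∑ⱼ 2 ^ (α i + β j) (⨍_{R i j z} g ^ s) ^ (1 / s)` from `L ^ p` to `L ^ q`
(`exists_lintegral_strongFracSum_le`). Since `s < p`, Minkowski's integral inequality lets the
`L ^ p` norm in one variable pass inside the `L ^ s` average in the other, so the one-parameter
bound `exists_lintegral_fracSum_le` can be applied twice. In one parameter, at each height the large
scales are controlled by the `L ^ p` norm and the small scales by a truncation of the function, and
the contributions of all heights form a geometric series.
-/

/-! ### Minkowski's integral inequality -/

/-- Minkowski's integral inequality with the inner integral replaced by a minorant `G` of finite
norm, which allows dividing by a power of `∫ G ^ r`. -/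
theorem lintegral_rpow_le_of_le_lintegral {X Y : Type*} [MeasurableSpace X] [MeasurableSpace Y]
    (μ : Measure X) [SFinite μ] (ν : Measure Y) [SFinite ν] {r : ℝ} (hr : 1 < r)
    {F : X → Y → ℝ≥0∞} (hF : Measurable (Function.uncurry F)) {G : Y → ℝ≥0∞} (hG : Measurable G)
    (hGF : ∀ y, G y ≤ ∫⁻ x, F x y ∂μ) (hfin : ∫⁻ y, G y ^ r ∂ν ≠ ∞) :
    (∫⁻ y, G y ^ r ∂ν) ^ (1 / r) ≤ ∫⁻ x, (∫⁻ y, F x y ^ r ∂ν) ^ (1 / r) ∂μ := by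
  set I := ∫⁻ y, G y ^ r ∂ν with hI
  set B := ∫⁻ x, (∫⁻ y, F x y ^ r ∂ν) ^ (1 / r) ∂μ with hB
  have hr0 : 0 < r := by linarith
  rcases eq_or_ne I 0 with h0 | h0
  · rw [h0, ENNReal.zero_rpow_of_pos (by positivity)]; exact zero_le
  have hconj : r.HolderConjugate (r / (r - 1)) := Real.HolderConjugate.conjExponent hr
  have key : I ≤ B * I ^ (1 / (r / (r - 1))) := by
    calc I ≤ ∫⁻ y, (∫⁻ x, F x y ∂μ) * G y ^ (r - 1) ∂ν := by
          refine lintegral_mono fun y => ?_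
          calc G y ^ r = G y ^ (1 : ℝ) * G y ^ (r - 1) := by
                rw [← ENNReal.rpow_add_of_nonneg _ _ zero_le_one (by linarith)]; congr 1; ring
            _ ≤ _ := by rw [ENNReal.rpow_one]; gcongr; exact hGF y
      _ = ∫⁻ y, ∫⁻ x, F x y * G y ^ (r - 1) ∂μ ∂ν := by
          refine lintegral_congr fun y => ?_
          rw [lintegral_mul_const]
          exact hF.comp (measurable_id.prodMk measurable_const)
      _ = ∫⁻ x, ∫⁻ y, F x y * G y ^ (r - 1) ∂ν ∂μ := by
          rw [lintegral_lintegral_swap]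
          exact ((hF.comp measurable_swap).mul
            ((hG.comp measurable_fst).pow_const _)).aemeasurable
      _ ≤ ∫⁻ x, (∫⁻ y, F x y ^ r ∂ν) ^ (1 / r) * I ^ (1 / (r / (r - 1))) ∂μ := by
          refine lintegral_mono fun x => ?_
          refine (ENNReal.lintegral_mul_le_Lp_mul_Lq ν hconj
            (f := fun y => F x y) (g := fun y => G y ^ (r - 1)) ?_ ?_).trans_eq ?_
          · exact (hF.comp (measurable_const.prodMk measurable_id)).aemeasurable
          · exact (hG.pow_const _).aemeasurable
          · congr 2
            refine lintegral_congr fun y => ?_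
            rw [← ENNReal.rpow_mul]; congr 1; field_simp [show r - 1 ≠ 0 by linarith]
      _ = _ := by
          rw [lintegral_mul_const]
          refine Measurable.pow_const ?_ _
          exact Measurable.lintegral_prod_right' (f := fun z : X × Y => F z.1 z.2 ^ r)
            (hF.pow_const r)
  have hsum : I ^ (1 / r) * I ^ (1 / (r / (r - 1))) = I := by
    rw [← ENNReal.rpow_add _ _ h0 hfin]
    have : 1 / r + 1 / (r / (r - 1)) = 1 := by
      field_simp [show r - 1 ≠ 0 by linarith]; ring
    rw [this, ENNReal.rpow_one]
  have hne : I ^ (1 / (r / (r - 1))) ≠ 0 := by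
    simp [ENNReal.rpow_eq_zero_iff, h0, hfin]
  have hne' : I ^ (1 / (r / (r - 1))) ≠ ∞ :=
    ENNReal.rpow_ne_top_of_nonneg (by have := hconj.symm.pos; positivity) hfin
  rw [← ENNReal.mul_le_mul_iff_left hne hne', hsum]
  exact key

/-- Minkowski's integral inequality. -/
theorem lintegral_rpow_lintegral_le {X Y : Type*} [MeasurableSpace X] [MeasurableSpace Y]
    (μ : Measure X) [SFinite μ] (ν : Measure Y) [SigmaFinite ν] {r : ℝ} (hr : 1 ≤ r)
    {F : X → Y → ℝ≥0∞} (hF : Measurable (Function.uncurry F)) :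
    (∫⁻ y, (∫⁻ x, F x y ∂μ) ^ r ∂ν) ^ (1 / r) ≤
      ∫⁻ x, (∫⁻ y, F x y ^ r ∂ν) ^ (1 / r) ∂μ := by
  rcases hr.eq_or_lt with rfl | hr
  · simp only [ENNReal.rpow_one, div_one]
    rw [lintegral_lintegral_swap]
    exact (hF.comp measurable_swap).aemeasurable
  have hr0 : 0 < r := by linarith
  set G : Y → ℝ≥0∞ := fun y => ∫⁻ x, F x y ∂μ with hGdef
  have hG : Measurable G := Measurable.lintegral_prod_left' (f := fun z : X × Y => F z.1 z.2) hF
  -- truncations with finite `r`-th moment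
  let T : ℕ → Y → ℝ≥0∞ := fun N => (spanningSets ν N).indicator fun y => min (G y) N
  have hT : ∀ N, Measurable (T N) := fun N =>
    (hG.min measurable_const).indicator (measurableSet_spanningSets ν N)
  have hTG : ∀ N y, T N y ≤ G y := fun N y =>
    (Set.indicator_le_self' (fun _ _ => zero_le) y).trans (min_le_left _ _)
  have hmono : Monotone T := by
    intro a b hab y
    refine (Set.indicator_le_indicator_of_subset (monotone_spanningSets ν hab)
      (fun _ => zero_le) y).trans (Set.indicator_le_indicator ?_)
    gcongr
  have hlim : ∀ y, ⨆ N, T N y = G y := by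
    intro y
    refine le_antisymm (iSup_le fun N => hTG N y) ?_
    refine le_of_forall_lt fun c hc => ?_
    obtain ⟨k, hk⟩ := ENNReal.exists_nat_gt hc.ne_top
    have hy : y ∈ spanningSets ν (max k (spanningSetsIndex ν y)) :=
      monotone_spanningSets ν (le_max_right _ _) (mem_spanningSetsIndex ν y)
    refine lt_of_lt_of_le ?_ (le_iSup _ (max k (spanningSetsIndex ν y)))
    simp only [T, Set.indicator_of_mem hy]
    refine lt_min hc (hk.trans_le ?_)
    exact_mod_cast le_max_left _ _
  have hstep : ∀ N, ∫⁻ y, T N y ^ r ∂ν ≤ (∫⁻ x, (∫⁻ y, F x y ^ r ∂ν) ^ (1 / r) ∂μ) ^ r := by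
    intro N
    have hfin : ∫⁻ y, T N y ^ r ∂ν ≠ ∞ := by
      have : ∫⁻ y, T N y ^ r ∂ν ≤
          ∫⁻ y, (spanningSets ν N).indicator (fun _ => (N : ℝ≥0∞) ^ r) y ∂ν := by
        refine lintegral_mono fun y => ?_
        by_cases hy : y ∈ spanningSets ν N
        · simp only [T, Set.indicator_of_mem hy]
          gcongr; exact min_le_right _ _
        · simp [T, Set.indicator_of_notMem hy, hr0]
      refine ne_top_of_le_ne_top ?_ this
      rw [lintegral_indicator_const (measurableSet_spanningSets ν N)]
      exact ENNReal.mul_ne_top (ENNReal.rpow_ne_top_of_nonneg hr0.le (by simp))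
        (measure_spanningSets_lt_top ν N).ne
    have := lintegral_rpow_le_of_le_lintegral μ ν hr hF (hT N) (hTG N) hfin
    exact (ENNReal.rpow_inv_le_iff hr0).1 (by rwa [one_div r] at this ⊢)
  rw [one_div, ENNReal.rpow_inv_le_iff hr0, ← one_div]
  calc ∫⁻ y, G y ^ r ∂ν = ∫⁻ y, ⨆ N, T N y ^ r ∂ν := by
        refine lintegral_congr fun y => ?_
        rw [← hlim y]
        exact (ENNReal.orderIsoRpow r hr0).map_iSup _
    _ = ⨆ N, ∫⁻ y, T N y ^ r ∂ν := by
        refine lintegral_iSup (fun N => (hT N).pow_const r) ?_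
        intro a b hab y
        dsimp only
        gcongr
        exact hmono hab y
    _ ≤ _ := iSup_le hstep

/-- Minkowski's inequality for countable sums. -/
theorem lintegral_rpow_tsum_le {ι Y : Type*} [Countable ι] [MeasurableSpace Y]
    (ν : Measure Y) [SigmaFinite ν] {r : ℝ} (hr : 1 ≤ r)
    {F : ι → Y → ℝ≥0∞} (hF : ∀ i, Measurable (F i)) :
    (∫⁻ y, (∑' i, F i y) ^ r ∂ν) ^ (1 / r) ≤ ∑' i, (∫⁻ y, F i y ^ r ∂ν) ^ (1 / r) := by
  let _ : MeasurableSpace ι := ⊤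
  have h := lintegral_rpow_lintegral_le (X := ι) Measure.count ν hr (F := F)
    (measurable_from_prod_countable_right hF)
  simpa only [lintegral_count] using h

/-! ### Powers of two and geometric series -/

/-- The power `2 ^ c` in `[0, ∞]`. -/
noncomputable def twoPow (c : ℝ) : ℝ≥0∞ := (2 : ℝ≥0∞) ^ c

theorem twoPow_add (a b : ℝ) : twoPow (a + b) = twoPow a * twoPow b :=
  ENNReal.rpow_add _ _ (by simp) (by simp)

theorem twoPow_rpow (a b : ℝ) : twoPow a ^ b = twoPow (a * b) := (ENNReal.rpow_mul _ _ _).symm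

theorem twoPow_ne_zero (a : ℝ) : twoPow a ≠ 0 := by simp [twoPow, ENNReal.rpow_eq_zero_iff]

theorem twoPow_ne_top (a : ℝ) : twoPow a ≠ ∞ := by simp [twoPow, ENNReal.rpow_eq_top_iff]

theorem twoPow_zero : twoPow 0 = 1 := ENNReal.rpow_zero

theorem twoPow_mono {a b : ℝ} (h : a ≤ b) : twoPow a ≤ twoPow b :=
  ENNReal.rpow_le_rpow_of_exponent_le (by norm_num) h

theorem twoPow_lt {a b : ℝ} (h : a < b) : twoPow a < twoPow b :=
  ENNReal.rpow_lt_rpow_of_exponent_lt (by norm_num) (by simp) h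

theorem twoPow_lt_iff {a b : ℝ} : twoPow a < twoPow b ↔ a < b :=
  ⟨fun h => by by_contra! h'; exact absurd (twoPow_mono h') (not_le.2 h), twoPow_lt⟩

theorem twoPow_neg (a : ℝ) : twoPow (-a) = (twoPow a)⁻¹ := ENNReal.rpow_neg _ _

theorem twoPow_eq_ofReal (a : ℝ) : twoPow a = ENNReal.ofReal ((2 : ℝ) ^ a) := by
  rw [twoPow, ← ENNReal.ofReal_rpow_of_pos (by norm_num)]; simp

theorem twoPow_zpow (a : ℝ) (k : ℤ) : twoPow a ^ k = twoPow (a * k) := by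
  rw [← ENNReal.rpow_intCast, twoPow_rpow]

/-- The value of the geometric series `∑ 2 ^ (-c k)` over `k : ℕ`. -/
noncomputable def geomConst (c : ℝ) : ℝ≥0∞ := ∑' k : ℕ, twoPow (-(c * k))

theorem geomConst_ne_top {c : ℝ} (hc : 0 < c) : geomConst c ≠ ∞ := by
  have : geomConst c = ∑' k : ℕ, twoPow (-c) ^ k := by
    refine tsum_congr fun k => ?_
    rw [← ENNReal.rpow_natCast, twoPow_rpow]; congr 1; ring
  rw [this, ENNReal.tsum_geometric, ENNReal.inv_ne_top]
  have : twoPow (-c) < 1 := by rw [← twoPow_zero]; exact twoPow_lt (by linarith)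
  exact (tsub_pos_of_lt this).ne'

theorem one_le_geomConst (c : ℝ) : 1 ≤ geomConst c := by
  refine le_trans ?_ (ENNReal.le_tsum 0)
  simp [twoPow_zero]

theorem tsum_twoPow_ge (c : ℝ) (j : ℤ) :
    ∑' i : ℤ, (if j ≤ i then twoPow (-(c * i)) else 0) = twoPow (-(c * j)) * geomConst c := by
  have hinj : Function.Injective (fun k : ℕ => j + (k : ℤ)) := fun a b h => by simpa using h
  rw [← hinj.tsum_eq]
  · rw [geomConst, ← ENNReal.tsum_mul_left]
    refine tsum_congr fun k => ?_
    rw [if_pos (by simp), ← twoPow_add]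
    congr 1; push_cast; ring
  · intro i hi
    by_cases h : j ≤ i
    · exact ⟨(i - j).toNat, by simp [h]⟩
    · simp [h] at hi

theorem tsum_twoPow_lt_le (c : ℝ) (j : ℤ) :
    ∑' i : ℤ, (if i < j then twoPow (c * i) else 0) ≤ twoPow (c * j) * geomConst c := by
  rw [← (Equiv.neg ℤ).tsum_eq]
  calc _ ≤ ∑' i : ℤ, (if -j ≤ i then twoPow (-(c * i)) else 0) := by
        refine ENNReal.tsum_le_tsum fun i => ?_
        simp only [Equiv.neg_apply]
        by_cases h : -i < j
        · rw [if_pos h, if_pos (by omega)]; push_cast; simp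
        · rw [if_neg h]; exact zero_le
    _ = _ := by rw [tsum_twoPow_ge]; push_cast; simp

/-- A geometric series cut off below `y` is comparable to `y`, its largest term. -/
theorem tsum_twoPow_cutoff_le {δ r : ℝ} (hδ : 0 < δ) (hr : 0 < r) (y : ℝ≥0∞) :
    ∑' j : ℤ, (if twoPow (-(δ * j)) < y then twoPow (-(δ * r * j)) else 0) ≤
      geomConst (δ * r) * y ^ r := by
  rcases eq_or_ne y 0 with rfl | hy0
  · simp
  rcases eq_or_ne y ∞ with rfl | hy
  · rw [ENNReal.top_rpow_of_pos hr, ENNReal.mul_top]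
    · exact le_top
    · exact (zero_lt_one.trans_le (one_le_geomConst _)).ne'
  obtain ⟨k, hk1, hk2⟩ := ENNReal.exists_mem_Ico_zpow hy0 hy (y := twoPow δ)
    (by rw [← twoPow_zero]; exact twoPow_lt hδ) (twoPow_ne_top _)
  rw [twoPow_zpow] at hk1 hk2
  calc _ ≤ ∑' j : ℤ, (if -k ≤ j then twoPow (-(δ * r * j)) else 0) := by
        refine ENNReal.tsum_le_tsum fun j => ?_
        by_cases h : twoPow (-(δ * j)) < y
        · rw [if_pos h, if_pos]
          have := twoPow_lt_iff.1 (h.trans hk2)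
          have h2 : δ * (-j : ℝ) < δ * ((k + 1 : ℤ) : ℝ) := by linarith
          have h3 := lt_of_mul_lt_mul_left h2 hδ.le
          have h4 : -j < k + 1 := by exact_mod_cast h3
          omega
        · rw [if_neg h]; exact zero_le
    _ = geomConst (δ * r) * twoPow (δ * k) ^ r := by
        rw [tsum_twoPow_ge, mul_comm, twoPow_rpow]; congr 2; push_cast; ring
    _ ≤ _ := by gcongr

/-! ### Cubes -/

section Cubes

variable {k : ℕ}

theorem mem_cube {c x : EuclideanSpace ℝ (Fin k)} {r : ℝ} :
    x ∈ cube c r ↔ ∀ i, |x i - c i| ≤ r := Iff.rfl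

theorem mem_cube_comm {c x : EuclideanSpace ℝ (Fin k)} {r : ℝ} : x ∈ cube c r ↔ c ∈ cube x r := by
  simp only [mem_cube, abs_sub_comm]

theorem cube_eq_preimage (c : EuclideanSpace ℝ (Fin k)) (r : ℝ) :
    cube c r = (WithLp.ofLp : EuclideanSpace ℝ (Fin k) → Fin k → ℝ) ⁻¹'
      Set.Icc (fun i => c i - r) (fun i => c i + r) := by
  ext x
  simp only [mem_cube, Set.mem_preimage, Set.mem_Icc, Pi.le_def, ← forall_and, abs_le]
  refine forall_congr' fun i => ?_
  constructor <;> rintro ⟨h1, h2⟩ <;> constructor <;> linarith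

theorem isClosed_cube (c : EuclideanSpace ℝ (Fin k)) (r : ℝ) : IsClosed (cube c r) := by
  rw [cube_eq_preimage]
  exact isClosed_Icc.preimage (PiLp.continuous_ofLp 2 _)

theorem measurableSet_cube (c : EuclideanSpace ℝ (Fin k)) (r : ℝ) : MeasurableSet (cube c r) :=
  (isClosed_cube c r).measurableSet

theorem volume_cube (c : EuclideanSpace ℝ (Fin k)) (r : ℝ) :
    volume (cube c r) = ENNReal.ofReal (2 * r) ^ k := by
  rw [cube_eq_preimage, (PiLp.volume_preserving_ofLp (Fin k)).measure_preimage
    measurableSet_Icc.nullMeasurableSet, Real.volume_Icc_pi]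
  simp only [add_sub_sub_cancel, ← two_mul, Finset.prod_const, Finset.card_univ, Fintype.card_fin]

theorem measurableSet_mem_cube (r : ℝ) :
    MeasurableSet {z : EuclideanSpace ℝ (Fin k) × EuclideanSpace ℝ (Fin k) | z.2 ∈ cube z.1 r} := by
  simp only [mem_cube, Set.ofPred_forall]
  refine MeasurableSet.iInter fun i => ?_
  refine (isClosed_le ?_ continuous_const).measurableSet
  fun_prop

theorem closedBall_subset_cube (c : EuclideanSpace ℝ (Fin k)) (r : ℝ) :
    Metric.closedBall c r ⊆ cube c r := by
  intro x hx i
  rw [mem_closedBall_iff_norm] at hx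
  exact (PiLp.norm_apply_le (x - c) i).trans hx

theorem cube_mono {c c' : EuclideanSpace ℝ (Fin k)} {r r' : ℝ} (h : ∀ i, |c i - c' i| + r ≤ r') :
    cube c r ⊆ cube c' r' := by
  intro x hx i
  calc |x i - c' i| ≤ |x i - c i| + |c i - c' i| := abs_sub_le _ _ _
    _ ≤ r' := by linarith [hx i, h i]

theorem dist_le_of_mem_cube {c x : EuclideanSpace ℝ (Fin k)} {r : ℝ} (hr : 0 ≤ r)
    (h : x ∈ cube c r) : dist x c ≤ (k : ℝ) * r := by
  rw [EuclideanSpace.dist_eq]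
  have h1 : ∑ i, dist (x i) (c i) ^ 2 ≤ (k * r) ^ 2 := by
    calc ∑ i, dist (x i) (c i) ^ 2 ≤ ∑ _i : Fin k, r ^ 2 := by
          refine Finset.sum_le_sum fun i _ => ?_
          rw [Real.dist_eq]
          exact pow_le_pow_left₀ (abs_nonneg _) (h i) 2
      _ = k * r ^ 2 := by simp
      _ ≤ (k * r) ^ 2 := by
          rw [mul_pow]
          rcases Nat.eq_zero_or_pos k with rfl | hk
          · simp
          · have : (1 : ℝ) ≤ k := by exact_mod_cast hk
            gcongr
            nlinarith
  exact (Real.sqrt_le_sqrt h1).trans (by rw [Real.sqrt_sq (by positivity)])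

theorem volume_cube_twoPow (c : EuclideanSpace ℝ (Fin k)) (i : ℤ) :
    volume (cube c ((2 : ℝ) ^ i)) = twoPow (k * (i + 1)) := by
  rw [volume_cube, ← zpow_one_add₀ (by norm_num), twoPow_eq_ofReal,
    ← ENNReal.ofReal_pow (by positivity), ← Real.rpow_intCast,
    ← Real.rpow_mul_natCast (by norm_num)]
  congr 2; push_cast; ring

end Cubes

/-! ### The one-parameter dyadic fractional integral -/

section OneParameter

variable {k : ℕ}

/-- The average of `φ` over the cube with centre `x` and side length `2 ^ (i + 1)`. -/
noncomputable def cubeAvg (i : ℤ) (φ : EuclideanSpace ℝ (Fin k) → ℝ≥0∞)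
    (x : EuclideanSpace ℝ (Fin k)) : ℝ≥0∞ :=
  twoPow (-(k * (i + 1))) * ∫⁻ u in cube x ((2 : ℝ) ^ i), φ u

theorem measurable_lintegral_cube {Y : Type*} [MeasurableSpace Y] (r : ℝ)
    {F : Y → EuclideanSpace ℝ (Fin k) → ℝ≥0∞} (hF : Measurable (Function.uncurry F)) :
    Measurable fun z : EuclideanSpace ℝ (Fin k) × Y => ∫⁻ u in cube z.1 r, F z.2 u := by
  have hS : MeasurableSet {z : (EuclideanSpace ℝ (Fin k) × Y) × EuclideanSpace ℝ (Fin k) |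
      z.2 ∈ cube z.1.1 r} :=
    (measurableSet_mem_cube r).preimage
      (f := fun z : (EuclideanSpace ℝ (Fin k) × Y) × EuclideanSpace ℝ (Fin k) => (z.1.1, z.2))
      (by exact (measurable_fst.comp measurable_fst).prodMk measurable_snd)
  have hm : Measurable fun z : (EuclideanSpace ℝ (Fin k) × Y) × EuclideanSpace ℝ (Fin k) =>
      F z.1.2 z.2 := hF.comp ((measurable_snd.comp measurable_fst).prodMk measurable_snd)
  have := Measurable.lintegral_prod_right' (ν := volume) (hm.indicator hS)
  refine (congrArg Measurable (funext fun z => ?_)).mp this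
  rw [← lintegral_indicator (measurableSet_cube _ _)]
  rfl

theorem measurable_cubeAvg (i : ℤ) {φ : EuclideanSpace ℝ (Fin k) → ℝ≥0∞} (hφ : Measurable φ) :
    Measurable (cubeAvg i φ) := by
  have := measurable_lintegral_cube (Y := Unit) (k := k) ((2 : ℝ) ^ i) (F := fun _ => φ)
    (hφ.comp measurable_snd)
  exact (this.comp (measurable_id.prodMk (measurable_const (a := ())))).const_mul _

theorem cubeAvg_mono (i : ℤ) {φ ψ : EuclideanSpace ℝ (Fin k) → ℝ≥0∞} (h : φ ≤ ψ) :
    cubeAvg i φ ≤ cubeAvg i ψ := fun x => by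
  unfold cubeAvg
  gcongr
  exact h _

theorem cubeAvg_const (i : ℤ) (c : ℝ≥0∞) (x : EuclideanSpace ℝ (Fin k)) :
    cubeAvg i (fun _ => c) x = c := by
  rw [cubeAvg, setLIntegral_const, volume_cube_twoPow, mul_left_comm, ← twoPow_add, neg_add_cancel,
    twoPow_zero, mul_one]

theorem cubeAvg_add (i : ℤ) {φ ψ : EuclideanSpace ℝ (Fin k) → ℝ≥0∞} (hφ : Measurable φ)
    (x : EuclideanSpace ℝ (Fin k)) :
    cubeAvg i (fun u => φ u + ψ u) x = cubeAvg i φ x + cubeAvg i ψ x := by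
  simp only [cubeAvg, lintegral_add_left hφ, mul_add]

theorem lintegral_cubeAvg (i : ℤ) {φ : EuclideanSpace ℝ (Fin k) → ℝ≥0∞} (hφ : Measurable φ) :
    ∫⁻ x, cubeAvg i φ x = ∫⁻ x, φ x := by
  have hS := measurableSet_mem_cube (k := k) ((2 : ℝ) ^ i)
  simp only [cubeAvg]
  rw [lintegral_const_mul' _ _ (twoPow_ne_top _)]
  simp_rw [← lintegral_indicator (measurableSet_cube _ _)]
  rw [lintegral_lintegral_swap]
  · have : ∀ u : EuclideanSpace ℝ (Fin k), ∫⁻ x, (cube x ((2 : ℝ) ^ i)).indicator φ u =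
        φ u * twoPow (k * (i + 1)) := by
      intro u
      rw [← volume_cube_twoPow u, ← setLIntegral_const,
        ← lintegral_indicator (measurableSet_cube _ _)]
      refine lintegral_congr fun x => ?_
      by_cases hx : u ∈ cube x ((2 : ℝ) ^ i)
      · rw [Set.indicator_of_mem hx, Set.indicator_of_mem (mem_cube_comm.1 hx)]
      · rw [Set.indicator_of_notMem hx, Set.indicator_of_notMem (fun h => hx (mem_cube_comm.1 h))]
    simp_rw [this]
    rw [lintegral_mul_const _ hφ, mul_left_comm, ← twoPow_add, neg_add_cancel, twoPow_zero, mul_one]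
  · refine Measurable.aemeasurable ?_
    exact (hφ.comp measurable_snd).indicator hS

theorem lintegral_le_rpow_mul_measure_univ {X : Type*} [MeasurableSpace X] (μ : Measure X) {r : ℝ}
    (hr : 1 < r) {φ : X → ℝ≥0∞} (hφ : AEMeasurable φ μ) :
    ∫⁻ x, φ x ∂μ ≤ (∫⁻ x, φ x ^ r ∂μ) ^ (1 / r) * μ Set.univ ^ (1 - 1 / r) := by
  have hconj : r.HolderConjugate (r / (r - 1)) := Real.HolderConjugate.conjExponent hr
  have h := ENNReal.lintegral_mul_le_Lp_mul_Lq μ hconj hφ (aemeasurable_const (b := (1 : ℝ≥0∞)))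
  have he : 1 / (r / (r - 1)) = 1 - 1 / r := by field_simp
  simpa [he] using h

/-- By Hölder's inequality an `L ^ s` average is at most the `L ^ p` average. -/
theorem cubeAvg_rpow_le_lintegral {s p : ℝ} (hs : 1 ≤ s) (hsp : s < p) (i : ℤ)
    {h : EuclideanSpace ℝ (Fin k) → ℝ≥0∞} (hh : Measurable h) (x : EuclideanSpace ℝ (Fin k)) :
    cubeAvg i (fun u => h u ^ s) x ^ (1 / s) ≤
      twoPow (-(k / p * i)) * (∫⁻ u, h u ^ p) ^ (1 / p) := by
  have hs0 : 0 < s := by linarith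
  have hp0 : 0 < p := by linarith
  have h1 := lintegral_le_rpow_mul_measure_univ (volume.restrict (cube x ((2 : ℝ) ^ i)))
    (r := p / s) (by rwa [one_lt_div hs0]) (φ := fun u => h u ^ s) (hh.pow_const s).aemeasurable
  simp only [← ENNReal.rpow_mul, Measure.restrict_apply_univ, volume_cube_twoPow, twoPow_rpow,
    mul_div_cancel₀ _ hs0.ne', one_div_div] at h1
  have h2 : cubeAvg i (fun u => h u ^ s) x ≤
      twoPow (-(k * (i + 1)) * (s / p)) * (∫⁻ u, h u ^ p) ^ (s / p) := by
    calc _ ≤ twoPow (-(k * (i + 1))) *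
          ((∫⁻ u in cube x ((2 : ℝ) ^ i), h u ^ p) ^ (s / p) *
            twoPow (k * (i + 1) * (1 - s / p))) := by
          unfold cubeAvg; gcongr
      _ = twoPow (-(k * (i + 1)) * (s / p)) *
          (∫⁻ u in cube x ((2 : ℝ) ^ i), h u ^ p) ^ (s / p) := by
          rw [mul_left_comm, ← twoPow_add, mul_comm]; congr 2; ring
      _ ≤ _ := by gcongr; exact Measure.restrict_le_self
  calc _ ≤ (twoPow (-(k * (i + 1)) * (s / p)) * (∫⁻ u, h u ^ p) ^ (s / p)) ^ (1 / s) := by gcongr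
    _ = twoPow (-(k * (i + 1)) / p) * (∫⁻ u, h u ^ p) ^ (1 / p) := by
        rw [ENNReal.mul_rpow_of_nonneg _ _ (by positivity), twoPow_rpow, ← ENNReal.rpow_mul]
        congr 2 <;> field_simp
    _ ≤ _ := by
        gcongr
        refine twoPow_mono ?_
        rw [div_mul_eq_mul_div, ← neg_div]
        gcongr
        nlinarith [Nat.cast_nonneg (α := ℝ) k]

/-- The dyadic fractional integral of order `a`, with `L ^ s` averages in place of averages. -/
noncomputable def fracSum (a s : ℝ) (h : EuclideanSpace ℝ (Fin k) → ℝ≥0∞)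
    (x : EuclideanSpace ℝ (Fin k)) : ℝ≥0∞ :=
  ∑' i : ℤ, twoPow (a * i) * cubeAvg i (fun u => h u ^ s) x ^ (1 / s)

/-- The scales below `2 ^ j` of the dyadic fractional integral of `h * 1_{h > τ}`. -/
noncomputable def truncFracSum (a s : ℝ) (j : ℤ) (τ : ℝ≥0∞)
    (h : EuclideanSpace ℝ (Fin k) → ℝ≥0∞) (x : EuclideanSpace ℝ (Fin k)) : ℝ≥0∞ :=
  ∑' i : ℤ, (if i < j then twoPow (a * i) else 0) *
    cubeAvg i ({u | τ < h u}.indicator fun u => h u ^ s) x ^ (1 / s)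

theorem measurable_fracSum (a s : ℝ) {h : EuclideanSpace ℝ (Fin k) → ℝ≥0∞} (hh : Measurable h) :
    Measurable (fracSum a s h) :=
  Measurable.tsum fun i => ((measurable_cubeAvg i (hh.pow_const s)).pow_const _).const_mul _

theorem measurable_truncFracSum (a s : ℝ) (j : ℤ) (τ : ℝ≥0∞)
    {h : EuclideanSpace ℝ (Fin k) → ℝ≥0∞} (hh : Measurable h) :
    Measurable (truncFracSum a s j τ h) :=
  Measurable.tsum fun i => ((measurable_cubeAvg i ((hh.pow_const s).indicator
    (measurableSet_lt measurable_const hh))).pow_const _).const_mul _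

/-- The large scales are controlled by the `L ^ p` norm, and the small scales of the part of `h`
below the height `τ` by `τ`; for the `τ` chosen here both bounds agree. -/
theorem fracSum_le_add_truncFracSum {a s p q : ℝ} (hs : 1 ≤ s) (hsp : s < p)
    (ha : a = k * (1 / p - 1 / q)) {h : EuclideanSpace ℝ (Fin k) → ℝ≥0∞} (hh : Measurable h)
    {H : ℝ≥0∞} (hH : (∫⁻ u, h u ^ p) ^ (1 / p) = H) (j : ℤ) (x : EuclideanSpace ℝ (Fin k)) :
    fracSum a s h x ≤ (geomConst (k / q) + geomConst a) * (twoPow (-(k / q * j)) * H) +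
      truncFracSum a s j (twoPow (-(k / p * j)) * H) h x := by
  have hs0 : 0 < s := by linarith
  have hp0 : 0 < p := by linarith
  set τ := twoPow (-(k / p * j)) * H with hτ
  have hsplit : ∀ i, cubeAvg i (fun u => h u ^ s) x ^ (1 / s) ≤
      τ + cubeAvg i ({u | τ < h u}.indicator fun u => h u ^ s) x ^ (1 / s) := by
    intro i
    have h1 : cubeAvg i (fun u => h u ^ s) x ≤
        τ ^ s + cubeAvg i ({u | τ < h u}.indicator fun u => h u ^ s) x := by
      have h2 : cubeAvg i (fun u => h u ^ s) x ≤
          cubeAvg i (fun u => τ ^ s + {u | τ < h u}.indicator (fun u => h u ^ s) u) x := by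
        refine cubeAvg_mono i (fun u => ?_) x
        by_cases hu : τ < h u
        · simp [Set.indicator_of_mem (show u ∈ {u | τ < h u} from hu)]
        · simp only [Set.indicator_of_notMem (show u ∉ {u | τ < h u} from hu), add_zero]
          have := not_lt.1 hu
          gcongr
      rwa [cubeAvg_add i measurable_const, cubeAvg_const] at h2
    calc _ ≤ (τ ^ s + cubeAvg i ({u | τ < h u}.indicator fun u => h u ^ s) x) ^ (1 / s) := by
          gcongr
      _ ≤ (τ ^ s) ^ (1 / s) + _ := ENNReal.rpow_add_le_add_rpow _ _ (by positivity)
          (by rw [div_le_one hs0]; exact hs)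
      _ = _ := by rw [← ENNReal.rpow_mul, mul_one_div_cancel hs0.ne', ENNReal.rpow_one]
  have hterm : ∀ i : ℤ, twoPow (a * i) * cubeAvg i (fun u => h u ^ s) x ^ (1 / s) ≤
      (if j ≤ i then twoPow (-(k / q * i)) else 0) * H +
      (if i < j then twoPow (a * i) else 0) * τ +
      (if i < j then twoPow (a * i) else 0) *
        cubeAvg i ({u | τ < h u}.indicator fun u => h u ^ s) x ^ (1 / s) := by
    intro i
    by_cases hij : i < j
    · rw [if_neg (not_le.2 hij), if_pos hij, zero_mul, zero_add, ← mul_add]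
      gcongr
      exact hsplit i
    · rw [if_pos (not_lt.1 hij), if_neg hij, zero_mul, zero_mul, add_zero, add_zero]
      calc _ ≤ twoPow (a * i) * (twoPow (-(k / p * i)) * H) := by
            gcongr
            exact (cubeAvg_rpow_le_lintegral hs hsp i hh x).trans_eq (by rw [hH])
        _ = _ := by
            rw [← mul_assoc, ← twoPow_add]; congr 2; rw [ha]; ring
  refine (ENNReal.tsum_le_tsum hterm).trans ?_
  rw [ENNReal.tsum_add, ENNReal.tsum_add, ENNReal.tsum_mul_right, ENNReal.tsum_mul_right,
    tsum_twoPow_ge]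
  unfold truncFracSum
  gcongr
  calc _ ≤ twoPow (-(k / q * j)) * geomConst (k / q) * H + twoPow (a * j) * geomConst a * τ := by
        gcongr; exact tsum_twoPow_lt_le a j
    _ = _ := by
        have : twoPow (a * j) * geomConst a * τ = geomConst a * (twoPow (-(k / q * j)) * H) := by
          rw [hτ, mul_comm (twoPow (a * j)), mul_assoc, ← mul_assoc (twoPow (a * j)), ← twoPow_add]
          congr 3; rw [ha]; ring
        rw [this]; ring

/-- If `Y` is at most the sum of `D 2 ^ (-δ j) H` and `S j` for every `j`, then the scale at which
the first term is about half of `Y` bounds `Y ^ q` by a sum over all scales. -/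
theorem rpow_le_tsum_of_forall_le_add {δ s q : ℝ} (hδ : 0 < δ) (hs : 0 < s) (hsq : s < q)
    {D H Y : ℝ≥0∞} (hD : 1 ≤ D) (hD' : D ≠ ∞) (hH : H ≠ 0) (hH' : H ≠ ∞) {S : ℤ → ℝ≥0∞}
    (hY : ∀ j : ℤ, Y ≤ D * (twoPow (-(δ * j)) * H) + S j) :
    Y ^ q ≤ (2 * D * twoPow δ) ^ q * ∑' j : ℤ, (twoPow (-(δ * j)) * H) ^ (q - s) * S j ^ s := by
  have hq : 0 < q := by linarith
  have hc0 : 2 * D * twoPow δ ≠ 0 := by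
    simp [twoPow_ne_zero, (zero_lt_one.trans_le hD).ne']
  have heH : ∀ j : ℤ, twoPow (-(δ * j)) * H ≠ 0 := fun j => mul_ne_zero (twoPow_ne_zero _) hH
  have heH' : ∀ j : ℤ, twoPow (-(δ * j)) * H ≠ ∞ := fun j =>
    ENNReal.mul_ne_top (twoPow_ne_top _) hH'
  rcases eq_or_ne Y 0 with rfl | hY0
  · rw [ENNReal.zero_rpow_of_pos hq]; exact zero_le
  rcases eq_or_ne Y ∞ with rfl | hY'
  · have hS : S 0 = ∞ := by
      have := hY 0
      rw [top_le_iff, ENNReal.add_eq_top] at this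
      exact this.resolve_left (ENNReal.mul_ne_top hD' (heH' 0))
    have : (twoPow (-(δ * ((0 : ℤ) : ℝ))) * H) ^ (q - s) * S 0 ^ s = ∞ := by
      rw [hS, ENNReal.top_rpow_of_pos hs, ENNReal.mul_top]
      exact (ENNReal.rpow_pos (pos_iff_ne_zero.2 (heH 0)) (heH' 0)).ne'
    rw [ENNReal.tsum_eq_top_of_eq_top ⟨0, this⟩, ENNReal.mul_top]
    · exact le_top
    · simp [ENNReal.rpow_eq_zero_iff, hc0, hq, hq.not_gt]
  have hZ0 : Y / (2 * D * H) ≠ 0 :=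
    ENNReal.div_ne_zero.2 ⟨hY0, ENNReal.mul_ne_top (ENNReal.mul_ne_top (by simp) hD') hH'⟩
  have h2DH : 2 * D * H ≠ 0 := by simp [(zero_lt_one.trans_le hD).ne', hH]
  have h2DH' : 2 * D * H ≠ ∞ := ENNReal.mul_ne_top (ENNReal.mul_ne_top (by simp) hD') hH'
  -- the scale `-m` at which `2 D 2 ^ (δ m) H` is the largest such value below `Y`
  obtain ⟨m, hm1, hm2⟩ := ENNReal.exists_mem_Ioc_zpow hZ0 (ENNReal.div_ne_top hY' h2DH)
    (y := twoPow δ) (by rw [← twoPow_zero]; exact twoPow_lt hδ) (twoPow_ne_top _)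
  rw [twoPow_zpow] at hm1 hm2
  set e := twoPow (-(δ * ((-m : ℤ) : ℝ))) * H with he
  have hme : twoPow (δ * m) * H = e := by rw [he]; congr 2; push_cast; ring
  have hlow : 2 * D * e < Y := by
    rw [ENNReal.lt_div_iff_mul_lt (Or.inl h2DH) (Or.inl h2DH')] at hm1
    calc 2 * D * e = twoPow (δ * m) * (2 * D * H) := by rw [← hme]; ring
      _ < Y := hm1
  have hup : Y ≤ 2 * D * twoPow δ * e := by
    rw [ENNReal.div_le_iff h2DH h2DH'] at hm2
    calc Y ≤ _ := hm2
      _ = 2 * D * twoPow δ * e := by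
        rw [← hme]; push_cast; rw [mul_add, mul_one, twoPow_add]; ring
  have hSe : e ≤ S (-m) := by
    by_contra! hlt
    have h1 := hY (-m)
    rw [← he] at h1
    have h2 : S (-m) ≤ D * e := hlt.le.trans (le_mul_of_one_le_left zero_le hD)
    have h3 : Y ≤ 2 * D * e := by
      calc Y ≤ D * e + D * e := h1.trans (by gcongr)
        _ = 2 * D * e := by ring
    exact absurd hlow (not_lt.2 h3)
  calc Y ^ q ≤ (2 * D * twoPow δ * e) ^ q := by gcongr
    _ = (2 * D * twoPow δ) ^ q * (e ^ (q - s) * e ^ s) := by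
        rw [ENNReal.mul_rpow_of_nonneg _ _ hq.le,
          ← ENNReal.rpow_add_of_nonneg _ _ (by linarith) hs.le]
        congr 2; ring
    _ ≤ (2 * D * twoPow δ) ^ q * (e ^ (q - s) * S (-m) ^ s) := by gcongr
    _ ≤ _ := by
        gcongr
        exact ENNReal.le_tsum (f := fun j : ℤ => (twoPow (-(δ * j)) * H) ^ (q - s) * S j ^ s) (-m)

theorem lintegral_truncFracSum_rpow_le (a : ℝ) {s : ℝ} (hs : 1 ≤ s) (j : ℤ) (τ : ℝ≥0∞)
    {h : EuclideanSpace ℝ (Fin k) → ℝ≥0∞} (hh : Measurable h) :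
    ∫⁻ x, truncFracSum a s j τ h x ^ s ≤
      (twoPow (a * j) * geomConst a) ^ s * ∫⁻ u, {u | τ < h u}.indicator (fun u => h u ^ s) u := by
  have hs0 : 0 < s := by linarith
  have hφ : Measurable ({u | τ < h u}.indicator fun u => h u ^ s) :=
    (hh.pow_const s).indicator (measurableSet_lt measurable_const hh)
  have h1 := lintegral_rpow_tsum_le (volume : Measure (EuclideanSpace ℝ (Fin k))) hs
    (F := fun (i : ℤ) x => (if i < j then twoPow (a * i) else 0) *
      cubeAvg i ({u | τ < h u}.indicator fun u => h u ^ s) x ^ (1 / s))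
    fun i => ((measurable_cubeAvg i hφ).pow_const _).const_mul _
  have h2 : ∀ i : ℤ, (∫⁻ x, ((if i < j then twoPow (a * i) else 0) *
      cubeAvg i ({u | τ < h u}.indicator fun u => h u ^ s) x ^ (1 / s)) ^ s) ^ (1 / s) =
      (if i < j then twoPow (a * i) else 0) *
        (∫⁻ u, {u | τ < h u}.indicator (fun u => h u ^ s) u) ^ (1 / s) := by
    intro i
    simp_rw [ENNReal.mul_rpow_of_nonneg _ _ hs0.le, ← ENNReal.rpow_mul, one_div_mul_cancel hs0.ne',
      ENNReal.rpow_one]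
    rw [lintegral_const_mul _ (measurable_cubeAvg i hφ), lintegral_cubeAvg i hφ,
      ENNReal.mul_rpow_of_nonneg _ _ (by positivity), ← ENNReal.rpow_mul,
      mul_one_div_cancel hs0.ne', ENNReal.rpow_one]
  simp_rw [h2] at h1
  rw [ENNReal.tsum_mul_right] at h1
  have h3 : (∫⁻ x, truncFracSum a s j τ h x ^ s) ^ (1 / s) ≤ (twoPow (a * j) * geomConst a) *
      (∫⁻ u, {u | τ < h u}.indicator (fun u => h u ^ s) u) ^ (1 / s) :=
    h1.trans (by gcongr; exact tsum_twoPow_lt_le a j)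
  rw [one_div, ENNReal.rpow_inv_le_iff hs0] at h3
  refine h3.trans_eq ?_
  rw [ENNReal.mul_rpow_of_nonneg _ _ hs0.le, ← ENNReal.rpow_mul, inv_mul_cancel₀ hs0.ne',
    ENNReal.rpow_one]

/-- The dyadic fractional integral with `L ^ s` averages maps `L ^ p` to `L ^ q`. -/
theorem exists_lintegral_fracSum_le (hk : 0 < k) {a s p q : ℝ} (hs : 1 ≤ s) (hsp : s < p)
    (hpq : p < q) (ha : a = k * (1 / p - 1 / q)) :
    ∃ C : ℝ≥0∞, C ≠ ∞ ∧ ∀ h : EuclideanSpace ℝ (Fin k) → ℝ≥0∞, Measurable h →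
      (∫⁻ x, fracSum a s h x ^ q) ^ (1 / q) ≤ C * (∫⁻ x, h x ^ p) ^ (1 / p) := by
  have hs0 : 0 < s := by linarith
  have hp0 : 0 < p := by linarith
  have hq0 : 0 < q := by linarith
  have hk0 : (0 : ℝ) < k := by exact_mod_cast hk
  have ha0 : 0 < a := by
    rw [ha]
    have : 1 / q < 1 / p := one_div_lt_one_div_of_lt hp0 hpq
    exact mul_pos hk0 (by linarith)
  have hps : 0 < p - s := by linarith
  set D := geomConst (k / q) + geomConst a with hDdef
  have hD : 1 ≤ D := (one_le_geomConst (k / q)).trans le_self_add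
  have hD' : D ≠ ∞ := ENNReal.add_ne_top.2
    ⟨geomConst_ne_top (by positivity), geomConst_ne_top ha0⟩
  set C := (2 * D * twoPow (k / q)) ^ q * (geomConst a ^ s * geomConst (k / p * (p - s))) with hC
  have hC' : C ≠ ∞ := by
    refine ENNReal.mul_ne_top (ENNReal.rpow_ne_top_of_nonneg hq0.le ?_) (ENNReal.mul_ne_top
      (ENNReal.rpow_ne_top_of_nonneg hs0.le (geomConst_ne_top ha0)) (geomConst_ne_top ?_))
    · exact ENNReal.mul_ne_top (ENNReal.mul_ne_top (by simp) hD') (twoPow_ne_top _)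
    · positivity
  have hC0 : C ^ (1 / q) + 1 ≠ 0 := by simp
  refine ⟨C ^ (1 / q) + 1, ENNReal.add_ne_top.2
    ⟨ENNReal.rpow_ne_top_of_nonneg (by positivity) hC', by simp⟩, fun h hh => ?_⟩
  generalize hH : (∫⁻ u, h u ^ p) ^ (1 / p) = H
  have hHp : ∫⁻ u, h u ^ p = H ^ p := by
    rw [← hH, ← ENNReal.rpow_mul, one_div_mul_cancel hp0.ne', ENNReal.rpow_one]
  rcases eq_or_ne H ∞ with rfl | hHtop
  · rw [ENNReal.mul_top hC0]; exact le_top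
  rcases eq_or_ne H 0 with rfl | hH0
  · have : ∀ x, fracSum a s h x = 0 := by
      intro x
      have h0 : ∀ i : ℤ, cubeAvg i (fun u => h u ^ s) x ^ (1 / s) = 0 := fun i => by
        have := cubeAvg_rpow_le_lintegral hs hsp i hh x
        rw [hH, mul_zero] at this
        exact le_antisymm this zero_le
      simp only [fracSum, h0, mul_zero, tsum_zero]
    simp [this, hq0]
  have hpt : ∀ x, fracSum a s h x ^ q ≤ (2 * D * twoPow (k / q)) ^ q *
      ∑' j : ℤ, (twoPow (-(k / q * j)) * H) ^ (q - s) *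
        truncFracSum a s j (twoPow (-(k / p * j)) * H) h x ^ s := fun x =>
    rpow_le_tsum_of_forall_le_add (by positivity) hs0 (hsp.trans hpq) hD hD' hH0 hHtop
      fun j => fracSum_le_add_truncFracSum hs hsp ha hh hH j x
  have hmeas : ∀ j : ℤ, Measurable fun x => (twoPow (-(k / q * j)) * H) ^ (q - s) *
      truncFracSum a s j (twoPow (-(k / p * j)) * H) h x ^ s := fun j =>
    ((measurable_truncFracSum a s j _ hh).pow_const s).const_mul _
  have hterm : ∀ j : ℤ, ∫⁻ x, (twoPow (-(k / q * j)) * H) ^ (q - s) *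
        truncFracSum a s j (twoPow (-(k / p * j)) * H) h x ^ s ≤
      ∫⁻ u, geomConst a ^ s * H ^ (q - s) * (h u ^ s *
        (if twoPow (-(k / p * j)) < h u / H then twoPow (-(k / p * (p - s) * j)) else 0)) := by
    intro j
    rw [lintegral_const_mul _ ((measurable_truncFracSum a s j _ hh).pow_const s)]
    refine (mul_le_mul_right (lintegral_truncFracSum_rpow_le a hs j _ hh) _).trans_eq ?_
    rw [← mul_assoc, ← lintegral_const_mul _
      ((hh.pow_const s).indicator (measurableSet_lt measurable_const hh))]
    refine lintegral_congr fun u => ?_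
    by_cases hu : twoPow (-(k / p * j)) * H < h u
    · rw [Set.indicator_of_mem (show u ∈ {u | twoPow (-(k / p * j)) * H < h u} from hu),
        if_pos (by rwa [ENNReal.lt_div_iff_mul_lt (Or.inl hH0) (Or.inl hHtop)]),
        ENNReal.mul_rpow_of_nonneg _ _ (by linarith), ENNReal.mul_rpow_of_nonneg _ _ hs0.le,
        twoPow_rpow, twoPow_rpow]
      have : twoPow (-(k / p * (p - s) * j)) =
          twoPow (-(k / q * j) * (q - s)) * twoPow (a * j * s) := by
        rw [← twoPow_add, ha]; congr 1; field_simp; ring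
      rw [this]; ring
    · rw [Set.indicator_of_notMem (show u ∉ {u | twoPow (-(k / p * j)) * H < h u} from hu),
        if_neg (by rwa [ENNReal.lt_div_iff_mul_lt (Or.inl hH0) (Or.inl hHtop)])]
      simp
  have hsum : ∫⁻ x, fracSum a s h x ^ q ≤ C * H ^ q := by
    calc ∫⁻ x, fracSum a s h x ^ q ≤ ∫⁻ x, (2 * D * twoPow (k / q)) ^ q *
          ∑' j : ℤ, (twoPow (-(k / q * j)) * H) ^ (q - s) *
            truncFracSum a s j (twoPow (-(k / p * j)) * H) h x ^ s := lintegral_mono hpt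
      _ = (2 * D * twoPow (k / q)) ^ q * ∑' j : ℤ, ∫⁻ x, (twoPow (-(k / q * j)) * H) ^ (q - s) *
            truncFracSum a s j (twoPow (-(k / p * j)) * H) h x ^ s := by
          rw [lintegral_const_mul _ (Measurable.tsum hmeas),
            lintegral_tsum fun j => (hmeas j).aemeasurable]
      _ ≤ (2 * D * twoPow (k / q)) ^ q * ∑' j : ℤ, ∫⁻ u, geomConst a ^ s * H ^ (q - s) * (h u ^ s *
          (if twoPow (-(k / p * j)) < h u / H then twoPow (-(k / p * (p - s) * j)) else 0)) := by
          exact mul_le_mul_right (ENNReal.tsum_le_tsum hterm) _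
      _ = (2 * D * twoPow (k / q)) ^ q * ∫⁻ u, geomConst a ^ s * H ^ (q - s) * (h u ^ s *
          ∑' j : ℤ, (if twoPow (-(k / p * j)) < h u / H then
            twoPow (-(k / p * (p - s) * j)) else 0)) := by
          rw [← lintegral_tsum]
          · simp_rw [ENNReal.tsum_mul_left]
          · intro j
            refine Measurable.aemeasurable ?_
            refine ((hh.pow_const s).mul (Measurable.ite ?_ measurable_const
              measurable_const)).const_mul _
            exact measurableSet_lt measurable_const (hh.div_const H)
      _ ≤ (2 * D * twoPow (k / q)) ^ q * ∫⁻ u, geomConst a ^ s * H ^ (q - s) * (h u ^ s *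
          (geomConst (k / p * (p - s)) * (h u / H) ^ (p - s))) := by
          gcongr with u
          exact tsum_twoPow_cutoff_le (by positivity) hps _
      _ = (2 * D * twoPow (k / q)) ^ q * ∫⁻ u, geomConst a ^ s * geomConst (k / p * (p - s)) *
          (H ^ (q - s) * (H ^ (p - s))⁻¹) * h u ^ p := by
          congr 1
          refine lintegral_congr fun u => ?_
          have : h u ^ p = h u ^ s * h u ^ (p - s) := by
            rw [← ENNReal.rpow_add_of_nonneg _ _ hs0.le hps.le]; congr 1; ring
          rw [this, ENNReal.div_rpow_of_nonneg _ _ hps.le]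
          simp only [div_eq_mul_inv]; ring
      _ = C * H ^ q := by
          rw [lintegral_const_mul _ (hh.pow_const p), hHp, hC, ← ENNReal.rpow_neg,
            ← ENNReal.rpow_add _ _ hH0 hHtop]
          have : H ^ q = H ^ (q - s + -(p - s)) * H ^ p := by
            rw [← ENNReal.rpow_add _ _ hH0 hHtop]; congr 1; ring
          rw [this]; ring
  calc _ ≤ (C * H ^ q) ^ (1 / q) := by gcongr
    _ = C ^ (1 / q) * H := by
        rw [ENNReal.mul_rpow_of_nonneg _ _ (by positivity), ← ENNReal.rpow_mul,
          mul_one_div_cancel hq0.ne', ENNReal.rpow_one]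
    _ ≤ _ := by gcongr; exact le_self_add

end OneParameter

/-! ### The two-parameter dyadic fractional integral -/

section TwoParameter

variable {n m : ℕ}

/-- The rectangle with centre `z` and side lengths `2 ^ (i + 1)`, `2 ^ (j + 1)`. -/
def dyadicRect (i j : ℤ) (z : ProdSpace n m) : Set (ProdSpace n m) :=
  cube z.1 ((2 : ℝ) ^ i) ×ˢ cube z.2 ((2 : ℝ) ^ j)

theorem isRectangle_dyadicRect (i j : ℤ) (z : ProdSpace n m) : IsRectangle (dyadicRect i j z) :=
  ⟨z.1, _, z.2, _, by positivity, by positivity, rfl⟩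

theorem volume_dyadicRect (i j : ℤ) (z : ProdSpace n m) :
    volume (dyadicRect i j z) = twoPow (n * (i + 1)) * twoPow (m * (j + 1)) := by
  rw [dyadicRect, Measure.volume_eq_prod, Measure.prod_prod, volume_cube_twoPow, volume_cube_twoPow]

theorem setAvg_dyadicRect (i j : ℤ) {φ : ProdSpace n m → ℝ≥0∞} (hφ : Measurable φ)
    (z : ProdSpace n m) :
    setAvg (dyadicRect i j z) φ = cubeAvg j (fun y => cubeAvg i (fun x => φ (x, y)) z.1) z.2 := by
  simp only [cubeAvg]
  rw [lintegral_const_mul' _ _ (twoPow_ne_top _), setAvg, volume_dyadicRect, ← twoPow_add,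
    ← mul_assoc, ← twoPow_neg, ← twoPow_add]
  congr 1
  · congr 1; ring
  · rw [dyadicRect, Measure.volume_eq_prod, ← Measure.prod_restrict,
      lintegral_prod_symm _ hφ.aemeasurable]

/-- The two-parameter dyadic fractional integral with `L ^ s` averages over centred rectangles. -/
noncomputable def strongFracSum (a b s : ℝ) (g : ProdSpace n m → ℝ≥0∞) (z : ProdSpace n m) :
    ℝ≥0∞ :=
  ∑' i : ℤ, ∑' j : ℤ, twoPow (a * i) * twoPow (b * j) *
    setAvg (dyadicRect i j z) (fun w => g w ^ s) ^ (1 / s)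

theorem measurable_sectionAvg (i : ℤ) {φ : ProdSpace n m → ℝ≥0∞} (hφ : Measurable φ) :
    Measurable fun z : ProdSpace n m => cubeAvg i (fun x => φ (x, z.2)) z.1 :=
  (measurable_lintegral_cube (Y := EuclideanSpace ℝ (Fin m)) ((2 : ℝ) ^ i)
    (F := fun y x => φ (x, y)) (hφ.comp measurable_swap)).const_mul _

theorem strongFracSum_eq (a b : ℝ) {s : ℝ} (hs : 0 < s) {g : ProdSpace n m → ℝ≥0∞}
    (hg : Measurable g) (z : ProdSpace n m) :
    strongFracSum a b s g z = ∑' i : ℤ, twoPow (a * i) *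
      fracSum b s (fun y => cubeAvg i (fun x => g (x, y) ^ s) z.1 ^ (1 / s)) z.2 := by
  unfold strongFracSum fracSum
  refine tsum_congr fun i => ?_
  rw [← ENNReal.tsum_mul_left]
  refine tsum_congr fun j => ?_
  rw [setAvg_dyadicRect i j (hg.pow_const s), mul_assoc]
  simp_rw [← ENNReal.rpow_mul, one_div_mul_cancel hs.ne', ENNReal.rpow_one]

/-- Minkowski's inequality moves the `L ^ p` norm in `y` inside the `L ^ s` average in `x`. -/
theorem lintegral_sectionAvg_rpow_le {s p : ℝ} (hs : 1 ≤ s) (hsp : s < p) (i : ℤ)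
    {g : ProdSpace n m → ℝ≥0∞} (hg : Measurable g) (x : EuclideanSpace ℝ (Fin n)) :
    (∫⁻ y, (cubeAvg i (fun x' => g (x', y) ^ s) x ^ (1 / s)) ^ p) ^ (1 / p) ≤
      cubeAvg i (fun x' => ((∫⁻ y, g (x', y) ^ p) ^ (1 / p)) ^ s) x ^ (1 / s) := by
  have hs0 : 0 < s := by linarith
  have hp0 : 0 < p := by linarith
  have hps : 0 < p / s := by positivity
  have h := lintegral_rpow_lintegral_le
    (volume.restrict (cube x ((2 : ℝ) ^ i))) (volume : Measure (EuclideanSpace ℝ (Fin m)))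
    (r := p / s) (by rw [le_div_iff₀ hs0]; linarith) (F := fun x' y => g (x', y) ^ s)
    (hg.pow_const s)
  have e1 : ∀ t : ℝ≥0∞, (t ^ (1 / s)) ^ p = t ^ (p / s) := fun t => by
    rw [← ENNReal.rpow_mul]; congr 1; ring
  have e2 : ∀ t : ℝ≥0∞, (t ^ s) ^ (p / s) = t ^ p := fun t => by
    rw [← ENNReal.rpow_mul]; congr 1; field_simp
  have e3 : ∀ t : ℝ≥0∞, (t ^ (1 / p)) ^ s = t ^ (1 / (p / s)) := fun t => by
    rw [← ENNReal.rpow_mul]; congr 1; field_simp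
  have e4 : ∀ t : ℝ≥0∞, t ^ (1 / p) = (t ^ (1 / (p / s))) ^ (1 / s) := fun t => by
    rw [← ENNReal.rpow_mul]; congr 1; field_simp
  simp only [e2] at h
  simp only [e1, e3]
  rw [e4]
  refine ENNReal.rpow_le_rpow ?_ (by positivity)
  simp only [cubeAvg]
  have hm : Measurable fun y => ∫⁻ x' in cube x ((2 : ℝ) ^ i), g (x', y) ^ s :=
    Measurable.lintegral_prod_left' (hg.pow_const s)
  simp_rw [ENNReal.mul_rpow_of_nonneg _ _ hps.le]
  rw [lintegral_const_mul _ (hm.pow_const _), ENNReal.mul_rpow_of_nonneg _ _ (by positivity),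
    ← ENNReal.rpow_mul, mul_one_div_cancel hps.ne', ENNReal.rpow_one]
  gcongr

theorem measurable_strongFracSum (a b s : ℝ) {g : ProdSpace n m → ℝ≥0∞} (hg : Measurable g) :
    Measurable (strongFracSum a b s g) := by
  refine Measurable.tsum fun i => Measurable.tsum fun j => ?_
  refine Measurable.const_mul (Measurable.pow_const ?_ _) _
  simp_rw [setAvg_dyadicRect i j (hg.pow_const s)]
  have h3 := measurable_lintegral_cube (Y := EuclideanSpace ℝ (Fin n)) ((2 : ℝ) ^ j)
    (F := fun x y => cubeAvg i (fun x' => g (x', y) ^ s) x)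
    (measurable_sectionAvg i (hg.pow_const s))
  exact (h3.comp measurable_swap).const_mul _

/-- On each fibre the one-parameter bound in `y` and Minkowski's inequality reduce the
two-parameter sum to the one-parameter sum in `x` of the fibrewise `L ^ p` norms. -/
theorem lintegral_strongFracSum_fibre_le (a : ℝ) {b s p q : ℝ} (hs : 1 ≤ s) (hsp : s < p)
    (hpq : p < q) {C : ℝ≥0∞} (hC : ∀ h : EuclideanSpace ℝ (Fin m) → ℝ≥0∞, Measurable h →
      (∫⁻ x, fracSum b s h x ^ q) ^ (1 / q) ≤ C * (∫⁻ x, h x ^ p) ^ (1 / p))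
    {g : ProdSpace n m → ℝ≥0∞} (hg : Measurable g) (x : EuclideanSpace ℝ (Fin n)) :
    (∫⁻ y, strongFracSum a b s g (x, y) ^ q) ^ (1 / q) ≤
      C * fracSum a s (fun x' => (∫⁻ y, g (x', y) ^ p) ^ (1 / p)) x := by
  have hs0 : 0 < s := by linarith
  have hq0 : 0 < q := by linarith
  let f : ℤ → EuclideanSpace ℝ (Fin m) → ℝ≥0∞ := fun i y =>
    cubeAvg i (fun x' => g (x', y) ^ s) x ^ (1 / s)
  have hf : ∀ i, Measurable (f i) := fun i => by
    have h1 := measurable_sectionAvg i (φ := fun w => g w ^ s) (hg.pow_const s)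
    have h2 : Measurable fun y => cubeAvg i (fun x' => g (x', y) ^ s) x :=
      h1.comp (measurable_const.prodMk measurable_id)
    exact h2.pow_const _
  have hfm : ∀ i, Measurable (fracSum b s (f i)) := fun i => measurable_fracSum b s (hf i)
  have hsum : ∀ y, strongFracSum a b s g (x, y) = ∑' i : ℤ, twoPow (a * i) * fracSum b s (f i) y :=
    fun y => strongFracSum_eq a b hs0 hg (x, y)
  have hterm : ∀ i : ℤ, (∫⁻ y, (twoPow (a * i) * fracSum b s (f i) y) ^ q) ^ (1 / q) ≤
      C * (twoPow (a * i) *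
        cubeAvg i (fun x' => ((∫⁻ y, g (x', y) ^ p) ^ (1 / p)) ^ s) x ^ (1 / s)) := by
    intro i
    simp_rw [ENNReal.mul_rpow_of_nonneg _ _ hq0.le]
    rw [lintegral_const_mul _ ((hfm i).pow_const q),
      ENNReal.mul_rpow_of_nonneg _ _ (by positivity), ← ENNReal.rpow_mul,
      mul_one_div_cancel hq0.ne', ENNReal.rpow_one, mul_left_comm]
    exact mul_le_mul_right ((hC _ (hf i)).trans
      (mul_le_mul_right (lintegral_sectionAvg_rpow_le hs hsp i hg x) C)) _
  calc (∫⁻ y, strongFracSum a b s g (x, y) ^ q) ^ (1 / q)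
      = (∫⁻ y, (∑' i : ℤ, twoPow (a * i) * fracSum b s (f i) y) ^ q) ^ (1 / q) := by
        simp_rw [hsum]
    _ ≤ ∑' i : ℤ, (∫⁻ y, (twoPow (a * i) * fracSum b s (f i) y) ^ q) ^ (1 / q) :=
        lintegral_rpow_tsum_le volume (by linarith) fun i => (hfm i).const_mul (twoPow (a * i))
    _ ≤ _ := by
        rw [fracSum, ← ENNReal.tsum_mul_left]
        exact ENNReal.tsum_le_tsum hterm

/-- The two-parameter dyadic fractional integral with `L ^ s` averages maps `L ^ p` to `L ^ q`. -/
theorem exists_lintegral_strongFracSum_le (hn : 0 < n) (hm : 0 < m) {a b s p q : ℝ} (hs : 1 ≤ s)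
    (hsp : s < p) (hpq : p < q) (ha : a = n * (1 / p - 1 / q)) (hb : b = m * (1 / p - 1 / q)) :
    ∃ C : ℝ≥0∞, C ≠ ∞ ∧ ∀ g : ProdSpace n m → ℝ≥0∞, Measurable g →
      (∫⁻ z, strongFracSum a b s g z ^ q) ^ (1 / q) ≤ C * (∫⁻ z, g z ^ p) ^ (1 / p) := by
  have hp0 : 0 < p := by linarith
  have hq0 : 0 < q := by linarith
  obtain ⟨C₁, hC₁, h₁⟩ := exists_lintegral_fracSum_le hn hs hsp hpq ha
  obtain ⟨C₂, hC₂, h₂⟩ := exists_lintegral_fracSum_le hm hs hsp hpq hb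
  refine ⟨C₂ * C₁, ENNReal.mul_ne_top hC₂ hC₁, fun g hg => ?_⟩
  set N : EuclideanSpace ℝ (Fin n) → ℝ≥0∞ := fun x => (∫⁻ y, g (x, y) ^ p) ^ (1 / p) with hN
  have hNm : Measurable N := (Measurable.lintegral_prod_right' (hg.pow_const p)).pow_const _
  have hNp : ∫⁻ x, N x ^ p = ∫⁻ z, g z ^ p := by
    rw [Measure.volume_eq_prod, lintegral_prod _ (hg.pow_const p).aemeasurable]
    refine lintegral_congr fun x => ?_
    rw [hN, ← ENNReal.rpow_mul, one_div_mul_cancel hp0.ne', ENNReal.rpow_one]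
  have hx : ∀ x : EuclideanSpace ℝ (Fin n),
      ∫⁻ y, strongFracSum a b s g (x, y) ^ q ≤ (C₂ * fracSum a s N x) ^ q := fun x => by
    have key := lintegral_strongFracSum_fibre_le a hs hsp hpq h₂ hg x
    rw [one_div, ENNReal.rpow_inv_le_iff hq0] at key
    exact key
  calc (∫⁻ z, strongFracSum a b s g z ^ q) ^ (1 / q)
      = (∫⁻ x, ∫⁻ y, strongFracSum a b s g (x, y) ^ q) ^ (1 / q) := by
        rw [Measure.volume_eq_prod,
          lintegral_prod _ ((measurable_strongFracSum a b s hg).pow_const q).aemeasurable]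
    _ ≤ (∫⁻ x, (C₂ * fracSum a s N x) ^ q) ^ (1 / q) := by gcongr with x; exact hx x
    _ = C₂ * (∫⁻ x, fracSum a s N x ^ q) ^ (1 / q) := by
        simp_rw [ENNReal.mul_rpow_of_nonneg _ _ hq0.le]
        rw [lintegral_const_mul _ ((measurable_fracSum a s hNm).pow_const q),
          ENNReal.mul_rpow_of_nonneg _ _ (by positivity), ← ENNReal.rpow_mul,
          mul_one_div_cancel hq0.ne', ENNReal.rpow_one]
    _ ≤ C₂ * (C₁ * (∫⁻ x, N x ^ p) ^ (1 / p)) := mul_le_mul_right (h₁ N hNm) _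
    _ = _ := by rw [hNp, mul_assoc]

end TwoParameter

/-! ### Stopping argument on a tree of boxes -/

section Tree

open Function

variable {X τ ι : Type*} [MeasurableSpace X] [Fintype ι]

/-- The sum over the generation-`k` descendants `t'` of `t` of `(ν t' / μ t') ^ ε * ν t'`, where a
node stands for its box. It is the integral of the `(1 + ε)`-th power of the conditional
expectation of `dν/dμ` on that generation. -/
noncomputable def treeEnergy (μ ν : Measure X) (box : τ → Set X) (child : τ → ι → τ) (ε : ℝ) :
    ℕ → τ → ℝ≥0∞
  | 0, t => (ν (box t) / μ (box t)) ^ ε * ν (box t)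
  | k + 1, t => ∑ i, treeEnergy μ ν box child ε k (child t i)

/-- The function whose integral is `treeEnergy`. On overlaps of boxes, the contributions add. -/
noncomputable def treeFun (μ ν : Measure X) (box : τ → Set X) (child : τ → ι → τ) (ε : ℝ) :
    ℕ → τ → X → ℝ≥0∞
  | 0, t => (box t).indicator fun _ => (ν (box t) / μ (box t)) ^ (1 + ε)
  | k + 1, t => fun z => ∑ i, treeFun μ ν box child ε k (child t i) z

variable {μ ν : Measure X} {box : τ → Set X} {child : τ → ι → τ} {ε : ℝ}

theorem measurable_treeFun (hbox : ∀ t, MeasurableSet (box t)) (k : ℕ) (t : τ) :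
    Measurable (treeFun μ ν box child ε k t) := by
  induction k generalizing t with
  | zero => exact measurable_const.indicator (hbox t)
  | succ k ih => exact Finset.measurable_sum _ fun i _ => ih (child t i)

theorem lintegral_treeFun (hε : 0 ≤ ε) (hbox : ∀ t, MeasurableSet (box t))
    (hμ0 : ∀ t, μ (box t) ≠ 0) (hμ : ∀ t, μ (box t) ≠ ∞) (k : ℕ) (t : τ) :
    ∫⁻ z, treeFun μ ν box child ε k t z ∂μ = treeEnergy μ ν box child ε k t := by
  induction k generalizing t with
  | zero =>
    rw [treeFun, treeEnergy, lintegral_indicator_const (hbox t), add_comm,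
      ENNReal.rpow_add_of_nonneg _ _ hε zero_le_one, ENNReal.rpow_one, mul_assoc,
      ENNReal.div_mul_cancel (hμ0 t) (hμ t)]
  | succ k ih =>
    simp only [treeFun, treeEnergy]
    rw [lintegral_finsetSum _ fun i _ => measurable_treeFun hbox k (child t i)]
    exact Finset.sum_congr rfl fun i _ => ih (child t i)

/-- Stopping at the maximal descendants on which `dν/dμ` has average above `lam` bounds the energy,
given a bound for fewer generations on the stopped boxes, whose union is `Ω`. -/
theorem exists_stopping_set {N lam F : ℝ≥0∞} (hbox : ∀ t, MeasurableSet (box t))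
    (hunion : ∀ t, ⋃ i, box (child t i) = box t)
    (hdisj : ∀ t, Pairwise (AEDisjoint ν on fun i => box (child t i)))
    (hN : ∀ t i, μ (box t) = N * μ (box (child t i))) (hN0 : N ≠ 0) (hN' : N ≠ ∞)
    (hμ0 : ∀ t, μ (box t) ≠ 0) (hμ : ∀ t, μ (box t) ≠ ∞) (hε : 0 < ε) {k : ℕ}
    (hF : ∀ j ≤ k, ∀ t, treeEnergy μ ν box child ε j t ≤
      F * (ν (box t) / μ (box t)) ^ ε * ν (box t))
    (j : ℕ) (hj : j ≤ k + 1) (t : τ) (ht : ν (box t) / μ (box t) ≤ lam) :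
    ∃ Ω ⊆ box t, MeasurableSet Ω ∧ lam * μ Ω ≤ ν (box t) ∧
      treeEnergy μ ν box child ε j t ≤ lam ^ ε * ν (box t) + F * (N * lam) ^ ε * ν Ω := by
  induction j generalizing t with
  | zero =>
    refine ⟨∅, Set.empty_subset _, MeasurableSet.empty, by simp, ?_⟩
    rw [measure_empty, mul_zero, add_zero, treeEnergy]
    gcongr
  | succ j ih =>
    have hsub : ∀ i, box (child t i) ⊆ box t := fun i => by
      rw [← hunion t]; exact Set.subset_iUnion (fun i => box (child t i)) i
    have hstep : ∀ i, ∃ Ω ⊆ box (child t i), MeasurableSet Ω ∧ lam * μ Ω ≤ ν (box (child t i)) ∧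
        treeEnergy μ ν box child ε j (child t i) ≤
          lam ^ ε * ν (box (child t i)) + F * (N * lam) ^ ε * ν Ω := by
      intro i
      by_cases hi : ν (box (child t i)) / μ (box (child t i)) ≤ lam
      · exact ih (by omega) (child t i) hi
      · refine ⟨_, subset_rfl, hbox _, ?_, ?_⟩
        · rw [not_le] at hi
          rw [← ENNReal.le_div_iff_mul_le (Or.inl (hμ0 _)) (Or.inl (hμ _))]
          exact hi.le
        · refine le_add_left ((hF j (by omega) (child t i)).trans ?_)
          gcongr
          calc ν (box (child t i)) / μ (box (child t i))
              ≤ ν (box t) / μ (box (child t i)) := by gcongr; exact hsub i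
            _ = N * (ν (box t) / μ (box t)) := by
                rw [hN t i, div_eq_mul_inv, div_eq_mul_inv,
                  ENNReal.mul_inv (Or.inl hN0) (Or.inl hN'), mul_left_comm N, ← mul_assoc N,
                  ENNReal.mul_inv_cancel hN0 hN', one_mul]
            _ ≤ N * lam := by gcongr
    choose Ω hΩsub hΩm hΩμ hΩν using hstep
    have hΩdisj : Pairwise (AEDisjoint ν on Ω) := fun a b hab =>
      (hdisj t hab).mono (hΩsub a) (hΩsub b)
    have hsumν : ∑ i, ν (box (child t i)) = ν (box t) := by
      rw [← hunion t, measure_iUnion₀ (hdisj t) fun i => (hbox _).nullMeasurableSet, tsum_fintype]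
    refine ⟨⋃ i, Ω i, ?_, MeasurableSet.iUnion hΩm, ?_, ?_⟩
    · exact Set.iUnion_subset fun i => (hΩsub i).trans (hsub i)
    · calc lam * μ (⋃ i, Ω i) ≤ lam * ∑ i, μ (Ω i) := by
            gcongr; exact measure_iUnion_fintype_le μ Ω
        _ = ∑ i, lam * μ (Ω i) := Finset.mul_sum _ _ _
        _ ≤ ∑ i, ν (box (child t i)) := Finset.sum_le_sum fun i _ => hΩμ i
        _ = ν (box t) := hsumν
    · rw [measure_iUnion₀ hΩdisj fun i => (hΩm i).nullMeasurableSet, tsum_fintype, ← hsumν,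
        Finset.mul_sum, Finset.mul_sum, ← Finset.sum_add_distrib]
      exact Finset.sum_le_sum fun i _ => hΩν i

/-- Reverse Hölder inequality on a tree of boxes, uniform in the number of generations: `hβ` makes
the part of the mass carried by the stopped boxes a fixed fraction of the total, so that the
constant `F` reproduces itself. -/
theorem treeEnergy_le {N F β : ℝ≥0∞} (hbox : ∀ t, MeasurableSet (box t))
    (hunion : ∀ t, ⋃ i, box (child t i) = box t)
    (hdisj : ∀ t, Pairwise (AEDisjoint ν on fun i => box (child t i)))
    (hN : ∀ t i, μ (box t) = N * μ (box (child t i))) (hN0 : N ≠ 0) (hN' : N ≠ ∞)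
    (hμ0 : ∀ t, μ (box t) ≠ 0) (hμ : ∀ t, μ (box t) ≠ ∞)
    (hν0 : ∀ t, ν (box t) ≠ 0) (hν : ∀ t, ν (box t) ≠ ∞) (hε : 0 < ε)
    (hβ : ∀ t, ∀ E ⊆ box t, MeasurableSet E → 2 * μ E ≤ μ (box t) → ν E ≤ β * ν (box t))
    (hF : 2 ^ ε + F * (N * 2) ^ ε * β ≤ F) (k : ℕ) (t : τ) :
    treeEnergy μ ν box child ε k t ≤ F * (ν (box t) / μ (box t)) ^ ε * ν (box t) := by
  induction k using Nat.strong_induction_on generalizing t with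
  | _ k ih =>
    rcases k with _ | k
    · rw [treeEnergy, mul_assoc]
      refine le_mul_of_one_le_left zero_le (le_trans ?_ (le_self_add.trans hF))
      exact ENNReal.one_le_rpow (by norm_num) hε
    · -- stop at twice the average, so that the stopped boxes fill at most half of `box t`
      set A := ν (box t) / μ (box t) with hA
      have hA0 : A ≠ 0 := ENNReal.div_ne_zero.2 ⟨hν0 t, hμ t⟩
      have hA' : A ≠ ∞ := ENNReal.div_ne_top (hν t) (hμ0 t)
      obtain ⟨Ω, hΩ, hΩm, hΩμ, hΩν⟩ := exists_stopping_set (lam := 2 * A) hbox hunion hdisj hN hN0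
        hN' hμ0 hμ hε (fun j hj t => ih j (by omega) t) (k + 1) le_rfl t
        (le_mul_of_one_le_left zero_le (by norm_num))
      have hsmall : 2 * μ Ω ≤ μ (box t) := by
        have h1 : ν (box t) = A * μ (box t) := (ENNReal.div_mul_cancel (hμ0 t) (hμ t)).symm
        rw [h1, mul_comm 2 A, mul_assoc] at hΩμ
        exact (ENNReal.mul_le_mul_iff_right hA0 hA').1 hΩμ
      calc _ ≤ (2 * A) ^ ε * ν (box t) + F * (N * (2 * A)) ^ ε * ν Ω := hΩν
        _ ≤ (2 * A) ^ ε * ν (box t) + F * (N * (2 * A)) ^ ε * (β * ν (box t)) := by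
            gcongr; exact hβ t Ω hΩ hΩm hsmall
        _ = (2 ^ ε + F * (N * 2) ^ ε * β) * A ^ ε * ν (box t) := by
            rw [← mul_assoc N, ENNReal.mul_rpow_of_nonneg _ A hε.le,
              ENNReal.mul_rpow_of_nonneg _ A hε.le]
            ring
        _ ≤ F * A ^ ε * ν (box t) := by gcongr

/-- The gain `ε` of the reverse Hölder inequality: as `ε → 0` the factor `(2 N) ^ ε * β` tends to
`β < 1`, so a finite `F` that satisfies the closing condition of `treeEnergy_le` exists. -/
theorem exists_reverseHolder_exponent {N β : ℝ≥0∞} (hN : 1 ≤ N) (hN' : N ≠ ∞) (hβ : β < 1) :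
    ∃ ε : ℝ, 0 < ε ∧ ∃ F : ℝ≥0∞, F ≠ ∞ ∧ 2 ^ ε + F * (N * 2) ^ ε * β ≤ F := by
  lift N to ℝ≥0 using hN'
  lift β to ℝ≥0 using hβ.ne_top
  have hβ1 : (β : ℝ) < 1 := by exact_mod_cast hβ
  have hN1 : (1 : ℝ) ≤ N := by exact_mod_cast hN
  have hlim : Filter.Tendsto (fun ε : ℝ => ((N : ℝ) * 2) ^ ε * β) (nhds 0) (nhds β) := by
    have : Continuous fun ε : ℝ => ((N : ℝ) * 2) ^ ε * (β : ℝ) :=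
      (Real.continuous_const_rpow (by positivity)).mul continuous_const
    simpa using this.tendsto 0
  have hev : ∀ᶠ ε in nhdsWithin (0 : ℝ) (Set.Ioi 0), ((N : ℝ) * 2) ^ ε * β < (1 + β) / 2 :=
    (hlim.mono_left nhdsWithin_le_nhds).eventually_lt_const (by linarith)
  obtain ⟨ε, ⟨hε, hε0⟩, hε1⟩ := ((hev.and self_mem_nhdsWithin).and
    (Ioo_mem_nhdsGT (zero_lt_one (α := ℝ)))).exists
  have hε0 : 0 < ε := hε0
  set F : ℝ := 4 / (1 - β) with hF
  have hF0 : 0 < F := div_pos (by norm_num) (by linarith)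
  refine ⟨ε, hε0, ENNReal.ofReal F, ENNReal.ofReal_ne_top, ?_⟩
  have h2 : (2 : ℝ) ^ ε ≤ 2 := by
    calc (2 : ℝ) ^ ε ≤ 2 ^ (1 : ℝ) := Real.rpow_le_rpow_of_exponent_le (by norm_num) hε1.2.le
      _ = 2 := by simp
  have hreal : (2 : ℝ) ^ ε + F * ((N : ℝ) * 2) ^ ε * β ≤ F := by
    have h3 : F * (((N : ℝ) * 2) ^ ε * β) ≤ F * ((1 + β) / 2) := by gcongr
    have h4 : F * ((1 + β) / 2) = F - 2 := by
      rw [hF]; field_simp [show (1 - β : ℝ) ≠ 0 by linarith]; ring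
    nlinarith
  have e1 : (2 : ℝ≥0∞) ^ ε = ENNReal.ofReal ((2 : ℝ) ^ ε) := twoPow_eq_ofReal ε
  have e2 : ((N : ℝ≥0∞) * 2) ^ ε = ENNReal.ofReal (((N : ℝ) * 2) ^ ε) := by
    rw [← ENNReal.ofReal_rpow_of_pos (by positivity), ENNReal.ofReal_mul (by positivity)]
    simp
  rw [e1, e2, ← ENNReal.ofReal_coe_nnreal (p := β), ← ENNReal.ofReal_mul hF0.le,
    ← ENNReal.ofReal_mul (by positivity), ← ENNReal.ofReal_add (by positivity) (by positivity)]
  exact ENNReal.ofReal_le_ofReal hreal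

end Tree

/-! ### The `A_∞` property of Muckenhoupt weights -/

/-- The `A_∞` property: by Hölder's inequality, a set that fills at least half of `R` carries a
fixed fraction of the `v`-mass of `R`; so its complement misses that fraction. -/
theorem setLIntegral_le_of_muckenhoupt {X : Type*} [MeasurableSpace X] {μ : Measure X} {p : ℝ}
    (hp : 1 < p) {w v : X → ℝ≥0∞} (hw : Measurable w) (hv : Measurable v)
    (hwv : ∀ᵐ z ∂μ, w z ^ (1 / p) * v z ^ ((p - 1) / p) = 1) {R : Set X} (hR0 : μ R ≠ 0)
    (hR' : μ R ≠ ∞) (hvR : ∫⁻ z in R, v z ∂μ ≠ ∞) {K L : ℝ≥0∞}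
    (hK : (∫⁻ z in R, w z ∂μ) * (∫⁻ z in R, v z ∂μ) ^ (p - 1) ≤ K * μ R ^ p)
    (hL : 2 ^ (p / (p - 1)) * K ^ (1 / (p - 1)) ≤ L)
    {E : Set X} (hER : E ⊆ R) (hE : MeasurableSet E) (hEμ : 2 * μ E ≤ μ R) :
    ∫⁻ z in E, v z ∂μ ≤ (1 - L⁻¹) * ∫⁻ z in R, v z ∂μ := by
  have hp0 : 0 < p := by linarith
  have hp1 : 0 < p - 1 := by linarith
  set p' := p / (p - 1) with hp'
  have hp'0 : 0 < p' := by positivity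
  have hconj : p.HolderConjugate p' := Real.HolderConjugate.conjExponent hp
  set V := ∫⁻ z in R, v z ∂μ
  set W := ∫⁻ z in R, w z ∂μ
  have hVsplit : V = ∫⁻ z in E, v z ∂μ + ∫⁻ z in R \ E, v z ∂μ := by
    have h := lintegral_inter_add_sdiff (μ := μ) v R hE
    rw [Set.inter_eq_self_of_subset_right hER] at h
    exact h.symm
  have hEtop : μ E ≠ ∞ := ne_top_of_le_ne_top hR' (measure_mono hER)
  -- the complement of `E` fills at least half of `R`
  have hhalf : μ R ≤ 2 * μ (R \ E) := by
    have h1 : μ R = μ E + μ (R \ E) := by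
      rw [measure_sdiff hER hE.nullMeasurableSet hEtop, add_tsub_cancel_of_le (measure_mono hER)]
    have h2 : μ E ≤ μ (R \ E) := by
      have : μ E + μ E ≤ μ E + μ (R \ E) := by rw [← two_mul, ← h1]; exact hEμ
      exact (ENNReal.add_le_add_iff_left hEtop).1 this
    calc μ R = μ E + μ (R \ E) := h1
      _ ≤ 2 * μ (R \ E) := by rw [two_mul]; gcongr
  have hhold : μ (R \ E) ≤ W ^ (1 / p) * (∫⁻ z in R \ E, v z ∂μ) ^ (1 / p') := by
    calc μ (R \ E) = ∫⁻ z in R \ E, w z ^ (1 / p) * v z ^ ((p - 1) / p) ∂μ := by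
          rw [lintegral_congr_ae (ae_restrict_of_ae hwv), setLIntegral_one]
      _ ≤ (∫⁻ z in R \ E, (w z ^ (1 / p)) ^ p ∂μ) ^ (1 / p) *
          (∫⁻ z in R \ E, (v z ^ ((p - 1) / p)) ^ p' ∂μ) ^ (1 / p') :=
          ENNReal.lintegral_mul_le_Lp_mul_Lq _ hconj (hw.pow_const _).aemeasurable
            (hv.pow_const _).aemeasurable
      _ = (∫⁻ z in R \ E, w z ∂μ) ^ (1 / p) * (∫⁻ z in R \ E, v z ∂μ) ^ (1 / p') := by
          have e : (p - 1) / p * p' = 1 := by rw [hp']; field_simp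
          simp_rw [← ENNReal.rpow_mul, one_div_mul_cancel hp0.ne', e, ENNReal.rpow_one]
      _ ≤ _ := by gcongr; exact lintegral_mono_set Set.sdiff_subset
  have hhold' : μ (R \ E) ^ p' ≤ W ^ (1 / (p - 1)) * ∫⁻ z in R \ E, v z ∂μ := by
    calc μ (R \ E) ^ p' ≤ (W ^ (1 / p) * (∫⁻ z in R \ E, v z ∂μ) ^ (1 / p')) ^ p' := by gcongr
      _ = _ := by
        rw [ENNReal.mul_rpow_of_nonneg _ _ hp'0.le, ← ENNReal.rpow_mul, ← ENNReal.rpow_mul,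
          one_div_mul_cancel hp'0.ne', ENNReal.rpow_one]
        congr 2; rw [hp']; field_simp
  have hK' : W ^ (1 / (p - 1)) * V ≤ K ^ (1 / (p - 1)) * μ R ^ p' := by
    have h := ENNReal.rpow_le_rpow hK (z := 1 / (p - 1)) (by positivity)
    rw [ENNReal.mul_rpow_of_nonneg _ _ (by positivity),
      ENNReal.mul_rpow_of_nonneg _ _ (by positivity), ← ENNReal.rpow_mul, ← ENNReal.rpow_mul,
      mul_one_div_cancel hp1.ne', ENNReal.rpow_one, mul_one_div] at h
    exact h
  have hmain : V ≤ L * ∫⁻ z in R \ E, v z ∂μ := by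
    have hc0 : μ R ^ p' ≠ 0 := (ENNReal.rpow_pos (pos_iff_ne_zero.2 hR0) hR').ne'
    have hc' : μ R ^ p' ≠ ∞ := ENNReal.rpow_ne_top_of_nonneg hp'0.le hR'
    rw [← ENNReal.mul_le_mul_iff_right hc0 hc']
    calc μ R ^ p' * V ≤ (2 * μ (R \ E)) ^ p' * V := by gcongr
      _ = 2 ^ p' * μ (R \ E) ^ p' * V := by rw [ENNReal.mul_rpow_of_nonneg _ _ hp'0.le]
      _ ≤ 2 ^ p' * (W ^ (1 / (p - 1)) * ∫⁻ z in R \ E, v z ∂μ) * V := by gcongr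
      _ = 2 ^ p' * (W ^ (1 / (p - 1)) * V) * ∫⁻ z in R \ E, v z ∂μ := by ring
      _ ≤ 2 ^ p' * (K ^ (1 / (p - 1)) * μ R ^ p') * ∫⁻ z in R \ E, v z ∂μ := by gcongr
      _ = μ R ^ p' * ((2 ^ p' * K ^ (1 / (p - 1))) * ∫⁻ z in R \ E, v z ∂μ) := by ring
      _ ≤ _ := by gcongr
  have hRE : ∫⁻ z in R \ E, v z ∂μ ≠ ∞ :=
    ne_top_of_le_ne_top hvR (lintegral_mono_set Set.sdiff_subset)
  have hmain' : L⁻¹ * V ≤ ∫⁻ z in R \ E, v z ∂μ := by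
    rw [mul_comm, ← div_eq_mul_inv]
    exact ENNReal.div_le_of_le_mul' hmain
  calc ∫⁻ z in E, v z ∂μ = V - ∫⁻ z in R \ E, v z ∂μ := by
        rw [hVsplit, ENNReal.add_sub_cancel_right hRE]
    _ ≤ V - L⁻¹ * V := by gcongr
    _ = _ := by rw [ENNReal.sub_mul fun _ _ => hvR, one_mul]

/-! ### Dyadic subdivision of rectangles -/

section Subdivision

open Function

variable {k n m : ℕ}

/-- The point `c + (± r, …, ± r)`, with signs given by `e`. -/
noncomputable def cornerShift (c : EuclideanSpace ℝ (Fin k)) (r : ℝ) (e : Fin k → Bool) :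
    EuclideanSpace ℝ (Fin k) :=
  WithLp.toLp 2 fun i => c i + if e i then r else -r

theorem iUnion_cube_cornerShift (c : EuclideanSpace ℝ (Fin k)) (r : ℝ) :
    ⋃ e, cube (cornerShift c (r / 2) e) (r / 2) = cube c r := by
  ext x
  simp only [Set.mem_iUnion, mem_cube, cornerShift, abs_le]
  constructor
  · rintro ⟨e, he⟩ i
    have := he i
    split_ifs at this <;> constructor <;> linarith [this.1, this.2]
  · intro h
    refine ⟨fun i => decide (c i ≤ x i), fun i => ?_⟩
    have := h i
    by_cases hc : c i ≤ x i
    · simp only [hc, decide_true, if_true]; constructor <;> linarith [this.1, this.2]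
    · simp only [hc, decide_false]
      rw [not_le] at hc
      simp only [Bool.false_eq_true, if_false]
      constructor <;> linarith [this.1, this.2]

/-- Two different children of a cube meet inside a hyperplane through its centre. -/
theorem volume_cube_cornerShift_inter (c : EuclideanSpace ℝ (Fin k)) (r : ℝ)
    {e e' : Fin k → Bool} (h : e ≠ e') :
    volume (cube (cornerShift c (r / 2) e) (r / 2) ∩ cube (cornerShift c (r / 2) e') (r / 2)) =
      0 := by
  obtain ⟨i, hi⟩ := Function.ne_iff.1 h
  have hplane : volume ((WithLp.ofLp : EuclideanSpace ℝ (Fin k) → Fin k → ℝ) ⁻¹'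
      {f | f i = c i}) = 0 := by
    have hm : MeasurableSet {f : Fin k → ℝ | f i = c i} :=
      measurableSet_eq_fun (measurable_pi_apply i) measurable_const
    rw [(PiLp.volume_preserving_ofLp (Fin k)).measure_preimage hm.nullMeasurableSet]
    exact Measure.pi_hyperplane (α := fun _ : Fin k => ℝ) (fun _ => volume) i (c i)
  refine measure_mono_null (fun x hx => ?_) hplane
  have h1 := abs_le.1 (hx.1 i)
  have h2 := abs_le.1 (hx.2 i)
  simp only [cornerShift] at h1 h2
  change x i = c i
  cases he : e i <;> cases he' : e' i <;> simp only [he, he'] at hi h1 h2 <;>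
    first
    | exact absurd rfl hi
    | (simp at h1 h2; linarith)

/-- The rectangle with centre `t.1` and half side lengths `r / 2 ^ t.2`, `s / 2 ^ t.2`. -/
def scaledRect (r s : ℝ) (t : ProdSpace n m × ℕ) : Set (ProdSpace n m) :=
  cube t.1.1 (r / 2 ^ t.2) ×ˢ cube t.1.2 (s / 2 ^ t.2)

/-- The children of a rectangle under simultaneous bisection of all its sides. -/
noncomputable def rectChild (r s : ℝ) (t : ProdSpace n m × ℕ)
    (e : (Fin n → Bool) × (Fin m → Bool)) : ProdSpace n m × ℕ :=
  ((cornerShift t.1.1 (r / 2 ^ t.2 / 2) e.1, cornerShift t.1.2 (s / 2 ^ t.2 / 2) e.2), t.2 + 1)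

theorem scaledRect_rectChild (r s : ℝ) (t : ProdSpace n m × ℕ)
    (e : (Fin n → Bool) × (Fin m → Bool)) :
    scaledRect r s (rectChild r s t e) =
      cube (cornerShift t.1.1 (r / 2 ^ t.2 / 2) e.1) (r / 2 ^ t.2 / 2) ×ˢ
        cube (cornerShift t.1.2 (s / 2 ^ t.2 / 2) e.2) (s / 2 ^ t.2 / 2) := by
  simp only [scaledRect, rectChild, pow_succ, div_div]

theorem isRectangle_scaledRect {r s : ℝ} (hr : 0 < r) (hs : 0 < s) (t : ProdSpace n m × ℕ) :
    IsRectangle (scaledRect r s t) :=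
  ⟨_, _, _, _, by positivity, by positivity, rfl⟩

theorem isClosed_scaledRect (r s : ℝ) (t : ProdSpace n m × ℕ) : IsClosed (scaledRect r s t) :=
  (isClosed_cube _ _).prod (isClosed_cube _ _)

theorem iUnion_scaledRect_rectChild (r s : ℝ) (t : ProdSpace n m × ℕ) :
    ⋃ e, scaledRect r s (rectChild r s t e) = scaledRect r s t := by
  simp_rw [scaledRect_rectChild]
  rw [Set.iUnion_prod', scaledRect, ← iUnion_cube_cornerShift t.1.1,
    ← iUnion_cube_cornerShift t.1.2]
  simp_rw [Set.iUnion_prod_const, Set.prod_iUnion]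

theorem aedisjoint_scaledRect_rectChild (r s : ℝ) (t : ProdSpace n m × ℕ) :
    Pairwise (AEDisjoint (volume : Measure (ProdSpace n m)) on
      fun e => scaledRect r s (rectChild r s t e)) := by
  intro e e' h
  change volume _ = 0
  simp only [scaledRect_rectChild, Set.prod_inter_prod]
  rw [Measure.volume_eq_prod, Measure.prod_prod]
  by_cases h1 : e.1 = e'.1
  · rw [volume_cube_cornerShift_inter t.1.2 (s / 2 ^ t.2) (fun h2 => h (Prod.ext h1 h2)), mul_zero]
  · rw [volume_cube_cornerShift_inter t.1.1 (r / 2 ^ t.2) h1, zero_mul]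

theorem volume_scaledRect (r s : ℝ) (t : ProdSpace n m × ℕ) :
    volume (scaledRect r s t) =
      ENNReal.ofReal (2 * (r / 2 ^ t.2)) ^ n * ENNReal.ofReal (2 * (s / 2 ^ t.2)) ^ m := by
  rw [scaledRect, Measure.volume_eq_prod, Measure.prod_prod, volume_cube, volume_cube]

theorem volume_scaledRect_eq_mul {r s : ℝ} (t : ProdSpace n m × ℕ)
    (e : (Fin n → Bool) × (Fin m → Bool)) :
    volume (scaledRect r s t) =
      2 ^ (n + m) * volume (scaledRect r s (rectChild r s t e)) := by
  have h2 : ∀ x : ℝ, ENNReal.ofReal (2 * x) = 2 * ENNReal.ofReal x := fun x => by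
    rw [ENNReal.ofReal_mul (by norm_num)]; simp
  have h : ∀ x : ℝ, ENNReal.ofReal (2 * (x / 2 ^ t.2)) =
      2 * ENNReal.ofReal (2 * (x / 2 ^ (t.2 + 1))) := fun x => by
    rw [← h2]; congr 1; rw [pow_succ]; field_simp
  rw [volume_scaledRect, volume_scaledRect, h r, h s]
  simp only [rectChild, mul_pow, pow_add]
  ring

theorem volume_pos_of_isRectangle {R : Set (ProdSpace n m)} (hR : IsRectangle R) :
    volume R ≠ 0 := by
  obtain ⟨c, r, d, s, hr, hs, rfl⟩ := hR
  rw [Measure.volume_eq_prod, Measure.prod_prod, volume_cube, volume_cube]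
  exact mul_ne_zero (pow_ne_zero _ (by simpa using hr)) (pow_ne_zero _ (by simpa using hs))

theorem volume_ne_top_of_isRectangle {R : Set (ProdSpace n m)} (hR : IsRectangle R) :
    volume R ≠ ∞ := by
  obtain ⟨c, r, d, s, hr, hs, rfl⟩ := hR
  rw [Measure.volume_eq_prod, Measure.prod_prod, volume_cube, volume_cube]
  exact ENNReal.mul_ne_top (ENNReal.pow_ne_top ENNReal.ofReal_ne_top)
      (ENNReal.pow_ne_top ENNReal.ofReal_ne_top)

theorem measurableSet_of_isRectangle {R : Set (ProdSpace n m)} (hR : IsRectangle R) :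
    MeasurableSet R := by
  obtain ⟨c, r, d, s, hr, hs, rfl⟩ := hR
  exact (measurableSet_cube _ _).prod (measurableSet_cube _ _)

end Subdivision

/-! ### Lebesgue differentiation along rectangles of a fixed shape -/

section Differentiation

open Metric Filter Topology

variable {n m : ℕ}

theorem dist_le_of_mem_scaledRect {r s : ℝ} (hr : 0 < r) (hs : 0 < s) {t : ProdSpace n m × ℕ}
    {z w : ProdSpace n m} (hz : z ∈ scaledRect r s t) (hw : w ∈ scaledRect r s t) :
    dist w z ≤ (2 * (n * r + m * s) + 1) / 2 ^ t.2 := by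
  have key : ∀ {k : ℕ} {ρ : ℝ}, 0 < ρ → ∀ {c x y : EuclideanSpace ℝ (Fin k)},
      x ∈ cube c (ρ / 2 ^ t.2) → y ∈ cube c (ρ / 2 ^ t.2) → dist x y ≤ 2 * (k * ρ) / 2 ^ t.2 := by
    intro k ρ hρ c x y hx hy
    have h1 := dist_le_of_mem_cube (by positivity) hx
    have h2 := dist_le_of_mem_cube (by positivity) hy
    calc dist x y ≤ dist x c + dist y c := dist_triangle_right _ _ _
      _ ≤ k * (ρ / 2 ^ t.2) + k * (ρ / 2 ^ t.2) := add_le_add h1 h2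
      _ = _ := by ring
  rw [Prod.dist_eq]
  refine max_le ((key hr hw.1 hz.1).trans ?_) ((key hs hw.2 hz.2).trans ?_) <;> gcongr <;>
    nlinarith [mul_nonneg (Nat.cast_nonneg (α := ℝ) n) hr.le,
      mul_nonneg (Nat.cast_nonneg (α := ℝ) m) hs.le]

/-- Lebesgue differentiation along rectangles of a fixed shape, not necessarily centred at the
point: such rectangles have measure comparable to that of the ball that contains them. -/
theorem ae_tendsto_setAvg_scaledRect {r s : ℝ} (hr : 0 < r) (hs : 0 < s)
    {h : ProdSpace n m → ℝ≥0∞} (hh : Measurable h) (hfin : ∫⁻ z, h z ≠ ∞) :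
    ∀ᵐ z, ∀ t : ℕ → ProdSpace n m, (∀ k, z ∈ scaledRect r s (t k, k)) →
      Tendsto (fun k => setAvg (scaledRect r s (t k, k)) h) atTop (𝓝 (h z)) := by
  set ρ : ℝ := 2 * (n * r + m * s) + 1 with hρ
  have hρ0 : 0 < ρ := by positivity
  have hvol : ∀ (x : ProdSpace n m) (a : ℝ), 0 ≤ a →
      volume (closedBall x a) = ENNReal.ofReal (a ^ Module.finrank ℝ (ProdSpace n m)) *
        volume (closedBall (0 : ProdSpace n m) 1) := fun x a ha => by
    rw [Measure.volume_eq_prod]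
    exact Measure.addHaar_closedBall' _ x ha
  set d := Module.finrank ℝ (ProdSpace n m)
  set C₁ : ℝ≥0∞ := ENNReal.ofReal (3 ^ d)
  set C₂ : ℝ≥0∞ := (ENNReal.ofReal (2 * (3 * ρ)) ^ n * ENNReal.ofReal (2 * (3 * ρ)) ^ m) /
    (ENNReal.ofReal (2 * r) ^ n * ENNReal.ofReal (2 * s) ^ m) with hC₂
  have hden0 : ENNReal.ofReal (2 * r) ^ n * ENNReal.ofReal (2 * s) ^ m ≠ 0 :=
    mul_ne_zero (pow_ne_zero _ (by simpa using hr)) (pow_ne_zero _ (by simpa using hs))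
  have hden : ENNReal.ofReal (2 * r) ^ n * ENNReal.ofReal (2 * s) ^ m ≠ ∞ :=
    ENNReal.mul_ne_top (ENNReal.pow_ne_top ENNReal.ofReal_ne_top)
      (ENNReal.pow_ne_top ENNReal.ofReal_ne_top)
  have hC₂' : C₂ ≠ ∞ := ENNReal.div_ne_top (ENNReal.mul_ne_top
      (ENNReal.pow_ne_top ENNReal.ofReal_ne_top) (ENNReal.pow_ne_top ENNReal.ofReal_ne_top)) hden0
  set C : ℝ≥0 := (C₁ + C₂).toNNReal
  have hC : (C : ℝ≥0∞) = C₁ + C₂ :=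
    ENNReal.coe_toNNReal (ENNReal.add_ne_top.2 ⟨ENNReal.ofReal_ne_top, hC₂'⟩)
  have hball : ∀ (x : ProdSpace n m) (a : ℝ), 0 < a →
      volume (closedBall x (3 * a)) ≤ C * volume (closedBall x a) := by
    intro x a ha
    rw [hvol x _ (by positivity), hvol x _ ha.le, mul_pow, ENNReal.ofReal_mul (by positivity), hC,
      ← mul_assoc]
    gcongr
    exact le_self_add
  have hrect : ∀ (x : ProdSpace n m) (t : ProdSpace n m × ℕ),
      volume (closedBall x (3 * (ρ / 2 ^ t.2))) ≤ C * volume (scaledRect r s t) := by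
    intro x t
    have h2 : ∀ y : ℝ, ENNReal.ofReal (2 * (y / 2 ^ t.2)) =
        ENNReal.ofReal (2 * y) * ENNReal.ofReal ((2 ^ t.2)⁻¹) := fun y => by
      rw [← ENNReal.ofReal_mul' (by positivity)]; congr 1; ring
    calc volume (closedBall x (3 * (ρ / 2 ^ t.2)))
        ≤ volume (scaledRect (3 * ρ) (3 * ρ) (x, t.2)) := by
          refine measure_mono ?_
          rw [← Prod.mk.eta (p := x), ← closedBall_prod_same, mul_div_assoc']
          exact Set.prod_mono (closedBall_subset_cube _ _) (closedBall_subset_cube _ _)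
      _ = C₂ * volume (scaledRect r s t) := by
          simp only [volume_scaledRect, h2, mul_pow]
          rw [mul_mul_mul_comm, mul_mul_mul_comm (ENNReal.ofReal (2 * r) ^ n),
            ← mul_assoc C₂, hC₂, ENNReal.div_mul_cancel hden0 hden]
      _ ≤ C * volume (scaledRect r s t) := by gcongr; rw [hC]; exact le_add_self
  have hfreq : ∀ x : ProdSpace n m, ∃ᶠ a in 𝓝[>] (0 : ℝ),
      volume (closedBall x (3 * a)) ≤ C * volume (closedBall x a) := fun x =>
    (Filter.Eventually.frequently (by
      filter_upwards [self_mem_nhdsWithin] with a ha using hball x a ha))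
  set F := Vitali.vitaliFamily (volume : Measure (ProdSpace n m)) C hfreq with hF
  have hint : ∀ t : ProdSpace n m × ℕ, (interior (scaledRect r s t)).Nonempty := by
    intro t
    refine ⟨t.1, mem_interior_iff_mem_nhds.2 ?_⟩
    refine prod_mem_nhds ?_ ?_ <;>
    · refine Filter.mem_of_superset (closedBall_mem_nhds _ ?_) (closedBall_subset_cube _ _)
      positivity
  filter_upwards [F.ae_tendsto_lintegral_div' hh hfin] with z hz t ht
  have htend : Tendsto (fun k => scaledRect r s (t k, k)) atTop (F.filterAt z) := by
    have hsub : ∀ k, scaledRect r s (t k, k) ⊆ closedBall z (ρ / 2 ^ k) := fun k w hw =>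
      mem_closedBall.2 (dist_le_of_mem_scaledRect hr hs (ht k) hw)
    rw [VitaliFamily.tendsto_filterAt_iff]
    refine ⟨Eventually.of_forall fun k => ?_, fun δ hδ => ?_⟩
    · exact ⟨isClosed_scaledRect _ _ _, hint _, ρ / 2 ^ k, hsub k, hrect z (t k, k)⟩
    · have hlim : Tendsto (fun k : ℕ => ρ / 2 ^ k) atTop (𝓝 0) :=
        tendsto_const_nhds.div_atTop (tendsto_pow_atTop_atTop_of_one_lt (by norm_num))
      filter_upwards [hlim.eventually_le_const hδ] with k hk
      exact (hsub k).trans (closedBall_subset_closedBall hk)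
  refine (hz.comp htend).congr fun k => ?_
  simp only [Function.comp, setAvg, ENNReal.div_eq_inv_mul]

end Differentiation

/-! ### Reverse Hölder inequality on rectangles -/

section ReverseHolder

open Filter Topology

variable {n m : ℕ}

theorem setLIntegral_ne_zero_of_isRectangle {g : ProdSpace n m → ℝ≥0∞} (hg : Measurable g)
    (hg0 : ∀ᵐ z, g z ≠ 0) {R : Set (ProdSpace n m)} (hR : IsRectangle R) :
    ∫⁻ z in R, g z ≠ 0 := by
  intro h
  rw [setLIntegral_eq_zero_iff (measurableSet_of_isRectangle hR) hg] at h
  refine volume_pos_of_isRectangle hR (measure_eq_zero_iff_ae_notMem.2 ?_)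
  filter_upwards [h, hg0] with z h1 h2 h3 using h2 (h1 h3)

/-- Each point of a rectangle lies in some descendant of generation `k`, whose average `treeFun`
dominates there. -/
theorem exists_descendant_le_treeFun {ν : Measure (ProdSpace n m)} {r s ε : ℝ} (k : ℕ)
    {t : ProdSpace n m × ℕ} {z : ProdSpace n m} (hz : z ∈ scaledRect r s t) :
    ∃ t' : ProdSpace n m × ℕ, t'.2 = t.2 + k ∧ z ∈ scaledRect r s t' ∧
      scaledRect r s t' ⊆ scaledRect r s t ∧
      (ν (scaledRect r s t') / volume (scaledRect r s t')) ^ (1 + ε) ≤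
        treeFun volume ν (scaledRect r s) (rectChild r s) ε k t z := by
  induction k generalizing t with
  | zero => exact ⟨t, rfl, hz, subset_rfl, by rw [treeFun, Set.indicator_of_mem hz]⟩
  | succ k ih =>
    have hz' := hz
    rw [← iUnion_scaledRect_rectChild r s t, Set.mem_iUnion] at hz'
    obtain ⟨e, he⟩ := hz'
    obtain ⟨t', h1, h2, h3, h4⟩ := ih he
    refine ⟨t', ?_, h2, h3.trans ?_, h4.trans ?_⟩
    · rw [h1]; simp only [rectChild]; omega
    · rw [← iUnion_scaledRect_rectChild r s t]
      exact Set.subset_iUnion (fun e => scaledRect r s (rectChild r s t e)) e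
    · simp only [treeFun]
      exact Finset.single_le_sum
        (f := fun e => treeFun volume ν (scaledRect r s) (rectChild r s) ε k (rectChild r s t e) z)
        (fun _ _ => zero_le) (Finset.mem_univ e)

/-- Passage to the limit in the number of generations, by Fatou's lemma and Lebesgue
differentiation. -/
theorem setLIntegral_rpow_le_of_treeEnergy_le {v : ProdSpace n m → ℝ≥0∞} (hv : Measurable v)
    {r s ε : ℝ} (hr : 0 < r) (hs : 0 < s) (hε : 0 < ε) (z₀ : ProdSpace n m)
    (hfin : ∫⁻ z in scaledRect r s (z₀, 0), v z ≠ ∞) {B : ℝ≥0∞}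
    (hB : ∀ k, treeEnergy volume (volume.withDensity v) (scaledRect r s) (rectChild r s) ε k
      (z₀, 0) ≤ B) :
    ∫⁻ z in scaledRect r s (z₀, 0), v z ^ (1 + ε) ≤ B := by
  set R := scaledRect r s (z₀, 0) with hR
  set ν := (volume : Measure (ProdSpace n m)).withDensity v with hν
  have hbox : ∀ t : ProdSpace n m × ℕ, MeasurableSet (scaledRect r s t) := fun t =>
    (isClosed_scaledRect r s t).measurableSet
  have hmeas : ∀ k, Measurable (treeFun volume ν (scaledRect r s) (rectChild r s) ε k (z₀, 0)) :=
    fun k => measurable_treeFun hbox k _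
  have hae := ae_tendsto_setAvg_scaledRect hr hs (h := R.indicator v) (hv.indicator (hbox _))
    (by rwa [lintegral_indicator (hbox _)])
  have hpt : ∀ᵐ z, z ∈ R → v z ^ (1 + ε) ≤
      liminf (fun k => treeFun volume ν (scaledRect r s) (rectChild r s) ε k (z₀, 0) z) atTop := by
    filter_upwards [hae] with z hz hzR
    choose t ht1 ht2 ht3 ht4 using fun k =>
      exists_descendant_le_treeFun (ν := ν) (ε := ε) k (t := (z₀, 0)) (z := z) hzR
    have ht : ∀ k, t k = ((t k).1, k) := fun k => Prod.ext rfl (by simpa using ht1 k)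
    have h1 := hz (fun k => (t k).1) fun k => by rw [← ht k]; exact ht2 k
    have h2 : ∀ k, setAvg (scaledRect r s ((t k).1, k)) (R.indicator v) =
        ν (scaledRect r s (t k)) / volume (scaledRect r s (t k)) := by
      intro k
      rw [← ht k, setAvg, setLIntegral_indicator (hbox _),
        Set.inter_eq_self_of_subset_right (ht3 k), hν, withDensity_apply _ (hbox _),
        ENNReal.div_eq_inv_mul]
    simp_rw [h2] at h1
    rw [Set.indicator_of_mem hzR] at h1
    have h3 := (ENNReal.continuous_rpow_const (y := 1 + ε)).continuousAt.tendsto.comp h1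
    rw [← h3.liminf_eq]
    exact liminf_le_liminf (Eventually.of_forall ht4)
  calc ∫⁻ z in R, v z ^ (1 + ε)
      ≤ ∫⁻ z in R, liminf (fun k =>
          treeFun volume ν (scaledRect r s) (rectChild r s) ε k (z₀, 0) z) atTop := by
        exact lintegral_mono_ae ((ae_restrict_iff' (hbox _)).2 hpt)
    _ ≤ ∫⁻ z, liminf (fun k =>
          treeFun volume ν (scaledRect r s) (rectChild r s) ε k (z₀, 0) z) atTop :=
        setLIntegral_le_lintegral _ _
    _ ≤ liminf (fun k => ∫⁻ z,
          treeFun volume ν (scaledRect r s) (rectChild r s) ε k (z₀, 0) z) atTop :=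
        lintegral_liminf_le hmeas
    _ ≤ B := by
        refine liminf_le_of_le (by isBoundedDefault) fun b hb => ?_
        obtain ⟨k, hk⟩ := hb.exists
        refine hk.trans ?_
        rw [lintegral_treeFun hε.le hbox
          (fun t => volume_pos_of_isRectangle (isRectangle_scaledRect hr hs t))
          (fun t => volume_ne_top_of_isRectangle (isRectangle_scaledRect hr hs t))]
        exact hB k

/-- Reverse Hölder inequality for the dual weight `v` of a product Muckenhoupt weight `w`, on all
rectangles. The children of a rectangle under simultaneous bisection are rectangles too, so the
one-parameter stopping argument applies inside each rectangle. -/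
theorem exists_reverseHolder (n m : ℕ) {p : ℝ} (hp : 1 < p) (K : ℝ≥0) :
    ∃ ε : ℝ, 0 < ε ∧ ∃ F : ℝ≥0∞, F ≠ ∞ ∧ ∀ w v : ProdSpace n m → ℝ≥0∞, Measurable w →
      Measurable v → (∀ᵐ z, w z ^ (1 / p) * v z ^ ((p - 1) / p) = 1) →
      (∀ R, IsRectangle R → setAvg R w * setAvg R v ^ (p - 1) ≤ K) →
      ∀ R, IsRectangle R → setAvg R (fun z => v z ^ (1 + ε)) ≤ F * setAvg R v ^ (1 + ε) := by
  have hp0 : 0 < p := by linarith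
  have hp1 : 0 < p - 1 := by linarith
  set L : ℝ≥0∞ := 2 ^ (p / (p - 1)) * (K : ℝ≥0∞) ^ (1 / (p - 1)) with hL
  have hL' : L ≠ ∞ := ENNReal.mul_ne_top (ENNReal.rpow_ne_top_of_nonneg (by positivity) (by simp))
    (ENNReal.rpow_ne_top_of_nonneg (by positivity) (by simp))
  have hβ : 1 - L⁻¹ < 1 :=
    ENNReal.sub_lt_self (by simp) (by simp) (ENNReal.inv_ne_zero.2 hL')
  obtain ⟨ε, hε, F, hF', hF⟩ := exists_reverseHolder_exponent (N := 2 ^ (n + m))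
    (one_le_pow₀ (by norm_num)) (by simp) hβ
  refine ⟨ε, hε, F, hF', fun w v hw hv hwv hK R hR => ?_⟩
  have hK' : ∀ R : Set (ProdSpace n m), IsRectangle R →
      (∫⁻ z in R, w z) * (∫⁻ z in R, v z) ^ (p - 1) ≤ K * volume R ^ p := by
    intro R hR
    have h0 := volume_pos_of_isRectangle hR
    have h1 := volume_ne_top_of_isRectangle hR
    have h2 : ∀ g : ProdSpace n m → ℝ≥0∞, ∫⁻ z in R, g z = volume R * setAvg R g := fun g => by
      rw [setAvg, ← mul_assoc, ENNReal.mul_inv_cancel h0 h1, one_mul]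
    have h3 : volume R ^ p = volume R * volume R ^ (p - 1) := by
      conv_rhs => rw [← ENNReal.rpow_one (volume R), ← ENNReal.rpow_mul,
        ← ENNReal.rpow_add _ _ h0 h1]
      congr 1; ring
    rw [h2, h2, ENNReal.mul_rpow_of_nonneg _ _ hp1.le, mul_mul_mul_comm, ← h3, mul_comm]
    gcongr
    exact hK R hR
  have hw0 : ∀ᵐ z, w z ≠ 0 := by
    filter_upwards [hwv] with z hz h0
    rw [h0, ENNReal.zero_rpow_of_pos (by positivity), zero_mul] at hz
    exact zero_ne_one hz
  have hv0 : ∀ᵐ z, v z ≠ 0 := by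
    filter_upwards [hwv] with z hz h0
    rw [h0, ENNReal.zero_rpow_of_pos (by positivity), mul_zero] at hz
    exact zero_ne_one hz
  have hvfin : ∀ R : Set (ProdSpace n m), IsRectangle R → ∫⁻ z in R, v z ≠ ∞ := by
    intro R hR h
    have h1 := hK' R hR
    rw [h, ENNReal.top_rpow_of_pos hp1,
      ENNReal.mul_top (setLIntegral_ne_zero_of_isRectangle hw hw0 hR), top_le_iff] at h1
    exact ENNReal.mul_ne_top (by simp)
      (ENNReal.rpow_ne_top_of_nonneg hp0.le (volume_ne_top_of_isRectangle hR)) h1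
  obtain ⟨c, r, d, s, hr, hs, rfl⟩ := hR
  have hroot : cube c r ×ˢ cube d s = scaledRect r s ((c, d), 0) := by simp [scaledRect]
  rw [hroot]
  have hrect := fun t => isRectangle_scaledRect (n := n) (m := m) hr hs t
  have hbox : ∀ t : ProdSpace n m × ℕ, MeasurableSet (scaledRect r s t) := fun t =>
    (isClosed_scaledRect r s t).measurableSet
  have hvol0 := fun t => volume_pos_of_isRectangle (hrect t)
  have hvol := fun t => volume_ne_top_of_isRectangle (hrect t)
  set ν := (volume : Measure (ProdSpace n m)).withDensity v with hν
  have hνbox : ∀ t, ν (scaledRect r s t) = ∫⁻ z in scaledRect r s t, v z := fun t =>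
    withDensity_apply _ (hbox t)
  have henergy : ∀ k, treeEnergy volume ν (scaledRect r s) (rectChild r s) ε k ((c, d), 0) ≤
      F * (ν (scaledRect r s ((c, d), 0)) / volume (scaledRect r s ((c, d), 0))) ^ ε *
        ν (scaledRect r s ((c, d), 0)) := fun k =>
    treeEnergy_le hbox (iUnion_scaledRect_rectChild r s)
      (fun t a b hab => withDensity_absolutelyContinuous volume v
        (aedisjoint_scaledRect_rectChild r s t hab))
      volume_scaledRect_eq_mul (by simp) (by simp) hvol0 hvol
      (fun t => by rw [hνbox]; exact setLIntegral_ne_zero_of_isRectangle hv hv0 (hrect t))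
      (fun t => by rw [hνbox]; exact hvfin _ (hrect t)) hε
      (fun t E hE hEm hEμ => by
        rw [hνbox, withDensity_apply _ hEm]
        exact setLIntegral_le_of_muckenhoupt hp hw hv hwv (hvol0 t) (hvol t)
          (hvfin _ (hrect t)) (hK' _ (hrect t)) le_rfl hE hEm hEμ)
      hF k ((c, d), 0)
  have h := setLIntegral_rpow_le_of_treeEnergy_le hv hr hs hε (c, d) (hvfin _ (hrect _)) henergy
  have havg : ν (scaledRect r s ((c, d), 0)) / volume (scaledRect r s ((c, d), 0)) =
      setAvg (scaledRect r s ((c, d), 0)) v := by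
    rw [hνbox, ENNReal.div_eq_inv_mul, setAvg]
  calc setAvg (scaledRect r s ((c, d), 0)) (fun z => v z ^ (1 + ε))
      ≤ (volume (scaledRect r s ((c, d), 0)))⁻¹ *
        (F * setAvg (scaledRect r s ((c, d), 0)) v ^ ε * ν (scaledRect r s ((c, d), 0))) := by
        rw [← havg, setAvg]; gcongr
    _ = F * (setAvg (scaledRect r s ((c, d), 0)) v ^ ε *
          setAvg (scaledRect r s ((c, d), 0)) v) := by
        rw [hνbox]
        conv_rhs => enter [2, 2]; rw [setAvg]
        ring
    _ = _ := by
        rw [add_comm (1 : ℝ), ENNReal.rpow_add_of_nonneg _ _ hε.le zero_le_one, ENNReal.rpow_one]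

end ReverseHolder

/-! ### Pointwise control by the characteristic -/

section Maximal

open Filter Topology

variable {n m : ℕ}

theorem setAvg_congr_ae (R : Set (ProdSpace n m)) {φ ψ : ProdSpace n m → ℝ≥0∞}
    (h : φ =ᵐ[volume] ψ) : setAvg R φ = setAvg R ψ := by
  rw [setAvg, setAvg, lintegral_congr_ae (ae_restrict_of_ae h)]

theorem strongMaximal_congr_ae {φ ψ : ProdSpace n m → ℝ≥0∞} (h : φ =ᵐ[volume] ψ) :
    strongMaximal φ = strongMaximal ψ := by
  funext z
  simp only [strongMaximal, setAvg_congr_ae _ h]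

theorem setAvg_le_strongMaximal {R : Set (ProdSpace n m)} (hR : IsRectangle R)
    (φ : ProdSpace n m → ℝ≥0∞) {z : ProdSpace n m} (hz : z ∈ R) :
    setAvg R φ ≤ strongMaximal φ z :=
  le_iSup_of_le R (le_iSup_of_le hR (le_iSup_of_le hz le_rfl))

/-- On a rectangle `S` the strong maximal function is at least the average over `S`. -/
theorem setAvg_le_setAvg_strongMaximal {R S : Set (ProdSpace n m)} (hR : IsRectangle R)
    (hS : IsRectangle S) (hRS : R ⊆ S) (φ : ProdSpace n m → ℝ≥0∞) :
    setAvg S φ ≤ setAvg R (strongMaximal φ) := by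
  calc setAvg S φ = (volume R)⁻¹ * ∫⁻ _z in R, setAvg S φ := by
        rw [setLIntegral_const, mul_comm (setAvg S φ), ← mul_assoc, ENNReal.inv_mul_cancel
          (volume_pos_of_isRectangle hR) (volume_ne_top_of_isRectangle hR), one_mul]
    _ ≤ _ := by
        change _ ≤ (volume R)⁻¹ * ∫⁻ z in R, strongMaximal φ z
        gcongr _ * ?_
        exact setLIntegral_mono' (measurableSet_of_isRectangle hR) fun z hz =>
          setAvg_le_strongMaximal hS φ (hRS hz)

/-- The characteristic with the maximal function controls `ω` pointwise against the averages of `v`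
over all centred rectangles, however large: small rectangles `R` at `z` see a maximal function that
dominates each of these averages, and the averages of `ω ^ q` over `R` converge to `ω z ^ q`. -/
theorem ae_mul_setAvg_rpow_le {q c : ℝ} (hq : 0 < q) (hc : 0 < c) {ω v : ProdSpace n m → ℝ≥0∞}
    (hω : Measurable ω) (hv : ∀ R, IsRectangle R → setAvg R v ≠ 0) {A : ℝ≥0∞} (hA : A ≠ ∞)
    (hωA : ∀ R, IsRectangle R →
      setAvg R (fun z => ω z ^ q) ^ (1 / q) * setAvg R (strongMaximal v) ^ c ≤ A) :
    ∀ᵐ z, ∀ i j : ℤ, ω z * setAvg (dyadicRect i j z) v ^ c ≤ A := by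
  have hrpow0 : ∀ x : ℝ≥0∞, x ≠ 0 → x ^ c ≠ 0 := fun x hx => by
    simp [ENNReal.rpow_eq_zero_iff, hx, hc.not_gt]
  have hbig : ∀ N : ℕ, IsRectangle (dyadicRect (n := n) (m := m) N N 0) := fun N =>
    isRectangle_dyadicRect _ _ _
  have hfin : ∀ N : ℕ, ∫⁻ z in dyadicRect N N 0, ω z ^ q ≠ ∞ := by
    intro N h
    have h1 := hωA _ (hbig N)
    have h2 : setAvg (dyadicRect N N 0) (fun z => ω z ^ q) = ∞ := by
      rw [setAvg, h, ENNReal.mul_top]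
      exact ENNReal.inv_ne_zero.2 (volume_ne_top_of_isRectangle (hbig N))
    have h3 : setAvg (dyadicRect N N 0) (strongMaximal v) ≠ 0 := fun h0 =>
      hv _ (hbig N) (le_antisymm
        ((setAvg_le_setAvg_strongMaximal (hbig N) (hbig N) subset_rfl v).trans_eq h0) zero_le)
    rw [h2, ENNReal.top_rpow_of_pos (by positivity), ENNReal.top_mul (hrpow0 _ h3), top_le_iff]
      at h1
    exact hA h1
  have hae : ∀ᵐ z, ∀ N : ℕ, ∀ t : ℕ → ProdSpace n m, (∀ k, z ∈ scaledRect 1 1 (t k, k)) →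
      Tendsto (fun k => setAvg (scaledRect 1 1 (t k, k))
        ((dyadicRect N N 0).indicator fun z => ω z ^ q)) atTop
        (𝓝 ((dyadicRect N N 0).indicator (fun z => ω z ^ q) z)) := by
    rw [ae_all_iff]
    intro N
    refine ae_tendsto_setAvg_scaledRect one_pos one_pos
      ((hω.pow_const q).indicator (measurableSet_of_isRectangle (hbig N))) ?_
    rw [lintegral_indicator (measurableSet_of_isRectangle (hbig N))]
    exact hfin N
  filter_upwards [hae] with z hz i j
  set a := setAvg (dyadicRect i j z) v with ha
  have ha0 : a ^ c ≠ 0 := hrpow0 _ (hv _ (isRectangle_dyadicRect i j z))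
  -- `a` may be infinite, and then the bound says that `ω z = 0`
  rw [← ENNReal.le_div_iff_mul_le (Or.inl ha0) (Or.inr hA)]
  have hcentre : ∀ {k : ℕ} (x : EuclideanSpace ℝ (Fin k)) (r : ℝ), 0 ≤ r → x ∈ cube x r := by
    intro k x r hr i; simpa using hr
  have hzk : ∀ k, z ∈ scaledRect 1 1 (z, k) := fun k =>
    ⟨hcentre _ _ (by positivity), hcentre _ _ (by positivity)⟩
  obtain ⟨N, hN⟩ : ∃ N : ℕ, ‖z‖ + 1 ≤ (2 : ℝ) ^ N :=
    (pow_unbounded_of_one_lt _ (by norm_num)).imp fun _ h => h.le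
  have hsubN : ∀ k, scaledRect 1 1 (z, k) ⊆ dyadicRect N N 0 := by
    have key : ∀ {l : ℕ} (x : EuclideanSpace ℝ (Fin l)) (k : ℕ), ‖x‖ ≤ ‖z‖ →
        cube x (1 / 2 ^ k) ⊆ cube 0 ((2 : ℝ) ^ (N : ℤ)) := by
      intro l x k hx
      refine cube_mono fun i => ?_
      have h1 : |x i| ≤ ‖x‖ := PiLp.norm_apply_le x i
      have h2 : (1 : ℝ) / 2 ^ k ≤ 1 := by
        rw [div_le_one (by positivity)]; exact one_le_pow₀ (by norm_num)
      simp only [PiLp.zero_apply, sub_zero, zpow_natCast]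
      linarith
    exact fun k => Set.prod_mono (key _ k (norm_fst_le z)) (key _ k (norm_snd_le z))
  have hsub : ∀ᶠ k : ℕ in atTop, scaledRect 1 1 (z, k) ⊆ dyadicRect i j z := by
    have hlim : Tendsto (fun k : ℕ => (1 : ℝ) / 2 ^ k) atTop (𝓝 0) :=
      tendsto_const_nhds.div_atTop (tendsto_pow_atTop_atTop_of_one_lt (by norm_num))
    filter_upwards [hlim.eventually_le_const (show (0 : ℝ) < 2 ^ i by positivity),
      hlim.eventually_le_const (show (0 : ℝ) < 2 ^ j by positivity)] with k h1 h2
    exact Set.prod_mono (cube_mono fun _ => by simpa using h1)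
      (cube_mono fun _ => by simpa using h2)
  have hlim := hz N (fun _ => z) hzk
  rw [Set.indicator_of_mem (hsubN 0 (hzk 0))] at hlim
  have hlim' := (ENNReal.continuous_rpow_const (y := 1 / q)).continuousAt.tendsto.comp hlim
  rw [← ENNReal.rpow_mul, mul_one_div_cancel hq.ne', ENNReal.rpow_one] at hlim'
  refine le_of_tendsto hlim' ?_
  filter_upwards [hsub] with k hk
  have hrect : IsRectangle (scaledRect 1 1 (z, k)) := isRectangle_scaledRect one_pos one_pos _
  have hind : setAvg (scaledRect 1 1 (z, k)) ((dyadicRect N N 0).indicator fun z => ω z ^ q) =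
      setAvg (scaledRect 1 1 (z, k)) fun z => ω z ^ q := by
    rw [setAvg, setLIntegral_indicator (measurableSet_of_isRectangle (hbig N)),
      Set.inter_eq_self_of_subset_right (hsubN k), setAvg]
  simp only [Function.comp, hind]
  rw [ENNReal.le_div_iff_mul_le (Or.inl ha0) (Or.inr hA)]
  refine le_trans ?_ (hωA _ hrect)
  gcongr
  exact setAvg_le_setAvg_strongMaximal hrect (isRectangle_dyadicRect i j z) hk v

end Maximal

/-! ### Dyadic expansion of the kernel -/

section Kernel

variable {n m : ℕ}

theorem ofReal_rpow_norm_sub_le {k : ℕ} {c : ℝ} (hc : 0 < c) (x u : EuclideanSpace ℝ (Fin k)) :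
    ENNReal.ofReal ((1 / ‖x - u‖) ^ c) ≤
      twoPow c * ∑' i : ℤ, twoPow (-(c * i)) *
        (cube x ((2 : ℝ) ^ i)).indicator (fun _ => 1) u := by
  rcases eq_or_ne x u with rfl | hxu
  · simp [Real.zero_rpow hc.ne']
  have hd : 0 < ‖x - u‖ := norm_pos_iff.2 (sub_ne_zero.2 hxu)
  obtain ⟨i, hi1, hi2⟩ := exists_mem_Ioc_zpow hd (y := (2 : ℝ)) (by norm_num)
  have hmem : u ∈ cube x ((2 : ℝ) ^ (i + 1)) :=
    closedBall_subset_cube _ _ (by rwa [mem_closedBall_iff_norm'])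
  calc ENNReal.ofReal ((1 / ‖x - u‖) ^ c) ≤ ENNReal.ofReal (2 ^ (-(c * i))) := by
        refine ENNReal.ofReal_le_ofReal ?_
        calc (1 / ‖x - u‖) ^ c ≤ (1 / 2 ^ i : ℝ) ^ c := by gcongr
          _ = 2 ^ (-(c * i)) := by
            rw [one_div, ← Real.rpow_intCast, ← Real.rpow_neg (by norm_num),
              ← Real.rpow_mul (by norm_num)]
            congr 1; ring
    _ = twoPow c * (twoPow (-(c * ((i + 1 : ℤ) : ℝ))) *
          (cube x ((2 : ℝ) ^ (i + 1))).indicator (fun _ => 1) u) := by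
        rw [← twoPow_eq_ofReal, Set.indicator_of_mem hmem, mul_one, ← twoPow_add]
        congr 1; push_cast; ring
    _ ≤ _ := by
        gcongr
        exact ENNReal.le_tsum (f := fun i : ℤ => twoPow (-(c * i)) *
          (cube x ((2 : ℝ) ^ i)).indicator (fun _ => (1 : ℝ≥0∞)) u) (i + 1)

/-- The kernel is dominated by a sum over dyadic scales of normalised indicators of centred
rectangles. -/
theorem enorm_strongKernel_le {α β : ℝ} (hα : α < n) (hβ : β < m) (z w : ProdSpace n m) :
    ‖strongKernel α β z w‖ₑ ≤ twoPow (n - α) * twoPow (m - β) *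
      ∑' i : ℤ, ∑' j : ℤ, twoPow (-((n - α) * i)) * twoPow (-((m - β) * j)) *
        (dyadicRect i j z).indicator (fun _ => 1) w := by
  have h1 := ofReal_rpow_norm_sub_le (sub_pos.2 hα) z.1 w.1
  have h2 := ofReal_rpow_norm_sub_le (sub_pos.2 hβ) z.2 w.2
  have hind : ∀ i j : ℤ, (dyadicRect i j z).indicator (fun _ => (1 : ℝ≥0∞)) w =
      (cube z.1 ((2 : ℝ) ^ i)).indicator (fun _ => 1) w.1 *
        (cube z.2 ((2 : ℝ) ^ j)).indicator (fun _ => 1) w.2 := by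
    intro i j
    by_cases hx : w.1 ∈ cube z.1 ((2 : ℝ) ^ i) <;> by_cases hy : w.2 ∈ cube z.2 ((2 : ℝ) ^ j) <;>
      simp [dyadicRect, Set.indicator, hx, hy]
  rw [strongKernel, Real.enorm_eq_ofReal (by positivity), ENNReal.ofReal_mul (by positivity)]
  refine (mul_le_mul' h1 h2).trans_eq ?_
  rw [mul_mul_mul_comm, ← ENNReal.tsum_mul_right]
  congr 1
  refine tsum_congr fun i => ?_
  rw [← ENNReal.tsum_mul_left]
  refine tsum_congr fun j => ?_
  rw [hind]; ring

theorem lintegral_strongKernel_le {α β : ℝ} (hα : α < n) (hβ : β < m) {φ : ProdSpace n m → ℝ≥0∞}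
    (hφ : AEMeasurable φ) (z : ProdSpace n m) :
    ∫⁻ w, ‖strongKernel α β z w‖ₑ * φ w ≤ twoPow (n - α) * twoPow (m - β) * twoPow (n + m) *
      ∑' i : ℤ, ∑' j : ℤ, twoPow (α * i) * twoPow (β * j) * setAvg (dyadicRect i j z) φ := by
  have hm : ∀ i j : ℤ, AEMeasurable fun w => twoPow (-((n - α) * i)) * twoPow (-((m - β) * j)) *
      (dyadicRect i j z).indicator φ w := fun i j =>
    (hφ.indicator (measurableSet_of_isRectangle (isRectangle_dyadicRect i j z))).const_mul _
  have hterm : ∀ i j : ℤ, ∫⁻ w, twoPow (-((n - α) * i)) * twoPow (-((m - β) * j)) *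
      (dyadicRect i j z).indicator φ w =
      twoPow (n + m) * (twoPow (α * i) * twoPow (β * j) * setAvg (dyadicRect i j z) φ) := by
    intro i j
    have hR := isRectangle_dyadicRect i j z
    rw [lintegral_const_mul' _ _ (ENNReal.mul_ne_top (twoPow_ne_top _) (twoPow_ne_top _)),
      lintegral_indicator (measurableSet_of_isRectangle hR)]
    have h1 : ∫⁻ w in dyadicRect i j z, φ w =
        twoPow (n * (i + 1)) * twoPow (m * (j + 1)) * setAvg (dyadicRect i j z) φ := by
      rw [← volume_dyadicRect i j z, setAvg, ← mul_assoc, ENNReal.mul_inv_cancel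
        (volume_pos_of_isRectangle hR) (volume_ne_top_of_isRectangle hR), one_mul]
    rw [h1]
    simp only [← mul_assoc, ← twoPow_add]
    congr 2; ring
  calc ∫⁻ w, ‖strongKernel α β z w‖ₑ * φ w
      ≤ ∫⁻ w, twoPow (n - α) * twoPow (m - β) * ∑' i : ℤ, ∑' j : ℤ,
          twoPow (-((n - α) * i)) * twoPow (-((m - β) * j)) * (dyadicRect i j z).indicator φ w := by
        refine lintegral_mono fun w => ?_
        refine (mul_le_mul_left (enorm_strongKernel_le hα hβ z w) _).trans_eq ?_
        rw [mul_assoc, ← ENNReal.tsum_mul_right]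
        congr 1
        refine tsum_congr fun i => ?_
        rw [← ENNReal.tsum_mul_right]
        refine tsum_congr fun j => ?_
        by_cases hw : w ∈ dyadicRect i j z <;> simp [hw]
    _ = _ := by
        rw [lintegral_const_mul' _ _ (ENNReal.mul_ne_top (twoPow_ne_top _) (twoPow_ne_top _)),
          lintegral_tsum fun i => AEMeasurable.tsum fun j => hm i j, mul_assoc (_ * _)]
        congr 1
        rw [← ENNReal.tsum_mul_left]
        refine tsum_congr fun i => ?_
        rw [lintegral_tsum (hm i), ← ENNReal.tsum_mul_left]
        exact tsum_congr fun j => hterm i j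

end Kernel

/-! ### The two-weight inequality -/

section TwoWeight

variable {n m : ℕ}

/-- Hölder's inequality on a rectangle together with the reverse Hölder inequality for `v`. -/
theorem setAvg_mul_le_of_reverseHolder {p ε s : ℝ} (hp : 1 < p) (hε : 0 < ε)
    (hs : s = p * (1 + ε) / (1 + p * ε)) {g v φ : ProdSpace n m → ℝ≥0∞} (hg : Measurable g)
    (hv : Measurable v) (hφ : φ =ᵐ[volume] fun z => g z * v z ^ ((p - 1) / p)) {F : ℝ≥0∞}
    {R : Set (ProdSpace n m)} (hR : IsRectangle R)
    (hRH : setAvg R (fun z => v z ^ (1 + ε)) ≤ F * setAvg R v ^ (1 + ε)) :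
    setAvg R φ ≤ F ^ (1 - 1 / s) * setAvg R v ^ ((p - 1) / p) *
      setAvg R (fun z => g z ^ s) ^ (1 / s) := by
  have hp0 : 0 < p := by linarith
  have hpε : 0 < 1 + p * ε := by positivity
  have hs1 : 1 < s := by rw [hs, one_lt_div hpε]; nlinarith
  have hs0 : 0 < s := by linarith
  set s' := s / (s - 1) with hs'
  have hconj : s.HolderConjugate s' := Real.HolderConjugate.conjExponent hs1
  have hs'0 : 0 < s' := hconj.symm.pos
  have hinv : 1 / s' = 1 - 1 / s := by
    rw [hs']; field_simp
  have hinv' : (1 + ε) * (1 / s') = (p - 1) / p := by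
    rw [hinv, hs]; field_simp; ring
  have hexp : (p - 1) / p * s' = 1 + ε := by
    rw [← hinv']; field_simp
  have hnn : 0 ≤ 1 - 1 / s := by rw [← hinv]; positivity
  have h0 := volume_pos_of_isRectangle hR
  have h1 := volume_ne_top_of_isRectangle hR
  have hvolsplit : (volume R)⁻¹ = (volume R)⁻¹ ^ (1 / s) * (volume R)⁻¹ ^ (1 / s') := by
    rw [← ENNReal.rpow_add _ _ (ENNReal.inv_ne_zero.2 h1) (ENNReal.inv_ne_top.2 h0), hinv]
    norm_num
  calc setAvg R φ = (volume R)⁻¹ * ∫⁻ z in R, g z * v z ^ ((p - 1) / p) := by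
        rw [setAvg_congr_ae R hφ, setAvg]
    _ ≤ (volume R)⁻¹ * ((∫⁻ z in R, g z ^ s) ^ (1 / s) *
          (∫⁻ z in R, (v z ^ ((p - 1) / p)) ^ s') ^ (1 / s')) := by
        gcongr
        exact ENNReal.lintegral_mul_le_Lp_mul_Lq _ hconj hg.aemeasurable
          (hv.pow_const _).aemeasurable
    _ = setAvg R (fun z => g z ^ s) ^ (1 / s) *
          setAvg R (fun z => v z ^ (1 + ε)) ^ (1 / s') := by
        simp_rw [← ENNReal.rpow_mul, hexp]
        rw [setAvg, setAvg, ENNReal.mul_rpow_of_nonneg _ _ (by positivity),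
          ENNReal.mul_rpow_of_nonneg _ _ (by positivity)]
        conv_lhs => rw [hvolsplit]
        ring
    _ ≤ setAvg R (fun z => g z ^ s) ^ (1 / s) *
          (F * setAvg R v ^ (1 + ε)) ^ (1 / s') := by gcongr
    _ = _ := by
        rw [ENNReal.mul_rpow_of_nonneg _ _ (by positivity), ← ENNReal.rpow_mul, hinv', hinv]
        ring

theorem measurable_strongKernel (α β : ℝ) (z : ProdSpace n m) :
    Measurable (strongKernel α β z) := by
  unfold strongKernel
  fun_prop

theorem dual_weight_eq {p : ℝ} (s : ℝ≥0∞) : (s ^ p) ^ (-1 / (p - 1)) = (1 / s) ^ (p / (p - 1)) := by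
  rw [one_div, ENNReal.inv_rpow, ← ENNReal.rpow_neg, ← ENNReal.rpow_mul]
  congr 1; ring

/-- The pointwise estimate behind the two-weight inequality: in the dyadic expansion of the kernel,
the reverse Hölder inequality separates `|f| = (|f| σ) / σ` on each rectangle, and the average of
the dual weight is absorbed by `ω` through the characteristic. -/
theorem exists_ae_mul_lintegral_strongKernel_le {α β p q : ℝ} (hαn : α < n) (hβm : β < m)
    (hp : 1 < p) (hpq : p < q) (K : ℝ≥0) :
    ∃ s : ℝ, 1 < s ∧ s < p ∧ ∃ D : ℝ≥0∞, D ≠ ∞ ∧ ∀ ω σ : ProdSpace n m → ℝ≥0∞,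
      AEMeasurable ω volume → AEMeasurable σ volume →
      IsProductAp p (fun z => σ z ^ p) → productApChar p (fun z => σ z ^ p) ≤ K →
      muckenhouptMaximalChar p q ω σ ≠ ∞ →
      ∀ φ g : ProdSpace n m → ℝ≥0∞, AEMeasurable φ → Measurable g →
        (g =ᵐ[volume] fun z => φ z * σ z) →
        ∀ᵐ z, ω z * ∫⁻ w, ‖strongKernel α β z w‖ₑ * φ w ≤
          D * muckenhouptMaximalChar p q ω σ * strongFracSum α β s g z := by
  have hp0 : 0 < p := by linarith
  have hp1 : 0 < p - 1 := by linarith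
  have hq0 : 0 < q := by linarith
  obtain ⟨ε, hε, F, hF, hRH⟩ := exists_reverseHolder n m hp K
  have hpε : 0 < 1 + p * ε := by positivity
  set s := p * (1 + ε) / (1 + p * ε) with hs
  have hs1 : 1 < s := by rw [hs, one_lt_div hpε]; nlinarith
  have hsp : s < p := by
    rw [hs, div_lt_iff₀ hpε]
    have : 0 < p * ε * (p - 1) := by positivity
    nlinarith
  have hnn : 0 ≤ 1 - 1 / s := by
    rw [sub_nonneg, div_le_one (by linarith)]; exact hs1.le
  set D := twoPow (n - α) * twoPow (m - β) * twoPow (n + m) with hD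
  refine ⟨s, hs1, hsp, D * F ^ (1 - 1 / s), ?_, ?_⟩
  · refine ENNReal.mul_ne_top (ENNReal.mul_ne_top (ENNReal.mul_ne_top ?_ ?_) ?_)
      (ENNReal.rpow_ne_top_of_nonneg hnn hF) <;> exact twoPow_ne_top _
  intro ω σ hω hσ hAp hK hA φ g hφ hg hgφ
  set A := muckenhouptMaximalChar p q ω σ with hAdef
  set σ' := hσ.mk σ
  have hσ' : Measurable σ' := hσ.measurable_mk
  have hσσ' : σ =ᵐ[volume] σ' := hσ.ae_eq_mk
  set v : ProdSpace n m → ℝ≥0∞ := fun z => (1 / σ' z) ^ (p / (p - 1)) with hvdef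
  have hv : Measurable v := (measurable_const.div hσ').pow_const _
  have hvσ : (fun z => (1 / σ z) ^ (p / (p - 1))) =ᵐ[volume] v := by
    filter_upwards [hσσ'] with z hz
    rw [hvdef, hz]
  have hσ0 : ∀ᵐ z, σ' z ≠ 0 := by
    filter_upwards [hAp.ae_pos, hσσ'] with z h1 h2 h3
    rw [h2, h3, ENNReal.zero_rpow_of_pos hp0] at h1
    exact lt_irrefl _ h1
  have hσtop : ∀ᵐ z, σ' z ≠ ∞ := by
    filter_upwards [hAp.ae_lt_top, hσσ'] with z h1 h2 h3
    rw [h2, h3, ENNReal.top_rpow_of_pos hp0] at h1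
    exact lt_irrefl _ h1
  have hvroot : ∀ z, v z ^ ((p - 1) / p) = (σ' z)⁻¹ := fun z => by
    rw [hvdef, ← ENNReal.rpow_mul, one_div, show p / (p - 1) * ((p - 1) / p) = 1 by field_simp,
      ENNReal.rpow_one]
  have hwv : ∀ᵐ z, (σ' z ^ p) ^ (1 / p) * v z ^ ((p - 1) / p) = 1 := by
    filter_upwards [hσ0, hσtop] with z h1 h2
    rw [hvroot, ← ENNReal.rpow_mul, mul_one_div_cancel hp0.ne', ENNReal.rpow_one,
      ENNReal.mul_inv_cancel h1 h2]
  have hv0 : ∀ᵐ z, v z ≠ 0 := by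
    filter_upwards [hσtop] with z h1
    rw [hvdef]
    simp [ENNReal.rpow_eq_zero_iff, h1, (div_pos hp0 hp1).not_gt]
  have hKR : ∀ R, IsRectangle R →
      setAvg R (fun z => σ' z ^ p) * setAvg R v ^ (p - 1) ≤ K := by
    intro R hR
    have h1 : setAvg R (fun z => σ z ^ p) = setAvg R fun z => σ' z ^ p :=
      setAvg_congr_ae R (hσσ'.fun_comp fun t => t ^ p)
    have h2 : setAvg R (fun z => (σ z ^ p) ^ (-1 / (p - 1))) = setAvg R v := by
      simp_rw [dual_weight_eq]
      exact setAvg_congr_ae R hvσ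
    rw [← h1, ← h2]
    exact (le_iSup₂ (f := fun (R : Set (ProdSpace n m)) (_ : IsRectangle R) =>
      setAvg R (fun z => σ z ^ p) *
        setAvg R (fun z => (σ z ^ p) ^ (-1 / (p - 1))) ^ (p - 1)) R hR).trans hK
  have hRH' := hRH (fun z => σ' z ^ p) v (hσ'.pow_const p) hv hwv hKR
  have hvavg : ∀ R : Set (ProdSpace n m), IsRectangle R → setAvg R v ≠ 0 := fun R hR =>
    mul_ne_zero (ENNReal.inv_ne_zero.2 (volume_ne_top_of_isRectangle hR))
      (setLIntegral_ne_zero_of_isRectangle hv hv0 hR)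
  have hωA : ∀ R, IsRectangle R → setAvg R (fun z => hω.mk ω z ^ q) ^ (1 / q) *
      setAvg R (strongMaximal v) ^ ((p - 1) / p) ≤ A := by
    intro R hR
    have h1 : setAvg R (fun z => ω z ^ q) = setAvg R fun z => hω.mk ω z ^ q :=
      setAvg_congr_ae R (hω.ae_eq_mk.fun_comp fun t => t ^ q)
    rw [← strongMaximal_congr_ae hvσ, ← h1]
    exact le_iSup₂ (f := fun (R : Set (ProdSpace n m)) (_ : IsRectangle R) =>
      (setAvg R fun z => ω z ^ q) ^ (1 / q) *
        (setAvg R (strongMaximal fun w => (1 / σ w) ^ (p / (p - 1)))) ^ ((p - 1) / p)) R hR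
  have hφg : φ =ᵐ[volume] fun z => g z * v z ^ ((p - 1) / p) := by
    filter_upwards [hgφ, hσσ', hσ0, hσtop] with z h1 h2 h3 h4
    rw [h1, hvroot, h2, mul_assoc, ENNReal.mul_inv_cancel h3 h4, mul_one]
  filter_upwards [ae_mul_setAvg_rpow_le hq0 (div_pos hp1 hp0) hω.measurable_mk hvavg hA hωA,
    hω.ae_eq_mk] with z hz hωz
  have hterm : ∀ i j : ℤ, ω z * (twoPow (α * i) * twoPow (β * j) * setAvg (dyadicRect i j z) φ) ≤
      F ^ (1 - 1 / s) * A * (twoPow (α * i) * twoPow (β * j) *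
        setAvg (dyadicRect i j z) (fun w => g w ^ s) ^ (1 / s)) := by
    intro i j
    have hR := isRectangle_dyadicRect i j z
    calc _ ≤ ω z * (twoPow (α * i) * twoPow (β * j) * (F ^ (1 - 1 / s) *
          setAvg (dyadicRect i j z) v ^ ((p - 1) / p) *
          setAvg (dyadicRect i j z) (fun w => g w ^ s) ^ (1 / s))) := by
          gcongr
          exact setAvg_mul_le_of_reverseHolder hp hε hs hg hv hφg hR (hRH' _ hR)
      _ = F ^ (1 - 1 / s) * (ω z * setAvg (dyadicRect i j z) v ^ ((p - 1) / p)) *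
          (twoPow (α * i) * twoPow (β * j) *
            setAvg (dyadicRect i j z) (fun w => g w ^ s) ^ (1 / s)) := by ring
      _ ≤ _ := by
          gcongr
          rw [hωz]
          exact hz i j
  calc ω z * ∫⁻ w, ‖strongKernel α β z w‖ₑ * φ w
      ≤ ω z * (D * ∑' i : ℤ, ∑' j : ℤ,
          twoPow (α * i) * twoPow (β * j) * setAvg (dyadicRect i j z) φ) := by
        gcongr
        exact lintegral_strongKernel_le hαn hβm hφ z
    _ = D * ∑' i : ℤ, ∑' j : ℤ,
          ω z * (twoPow (α * i) * twoPow (β * j) * setAvg (dyadicRect i j z) φ) := by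
        rw [mul_left_comm]
        simp_rw [ENNReal.tsum_mul_left]
    _ ≤ D * ∑' i : ℤ, ∑' j : ℤ, F ^ (1 - 1 / s) * A * (twoPow (α * i) * twoPow (β * j) *
        setAvg (dyadicRect i j z) (fun w => g w ^ s) ^ (1 / s)) :=
        mul_le_mul_right (ENNReal.tsum_le_tsum fun i => ENNReal.tsum_le_tsum fun j => hterm i j) _
    _ = _ := by
        simp_rw [ENNReal.tsum_mul_left]
        rw [strongFracSum]
        ring

theorem eLpNorm_ofReal_eq_lintegral {X : Type*} [MeasurableSpace X] {μ : Measure X} {p : ℝ}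
    (hp : 0 < p) (h : X → ℝ≥0∞) :
    eLpNorm h (ENNReal.ofReal p) μ = (∫⁻ x, h x ^ p ∂μ) ^ (1 / p) := by
  rw [eLpNorm_eq_lintegral_rpow_enorm_toReal (by simpa using hp) ENNReal.ofReal_ne_top,
    ENNReal.toReal_ofReal hp.le]
  simp only [enorm_eq_self]

end TwoWeight

/-- Two-weight norm inequality for the strong fractional integral. For `f` with finite right-hand
side the integral that defines `I_{αβ} f` converges absolutely at almost every point where `ω`
does not vanish. -/
theorem mainTheorem1 (n m : ℕ) (α β p q : ℝ)
    (hα : 0 < α) (hαn : α < n) (hβ : 0 < β) (hβm : β < m)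
    (hp : 1 < p) (hpq : p < q)
    (hαpq : α / n = 1 / p - 1 / q) (hβpq : β / m = 1 / p - 1 / q)
    (K : ℝ≥0) :
    ∃ C : ℝ≥0, ∀ ω σ : ProdSpace n m → ℝ≥0∞,
      AEMeasurable ω volume → AEMeasurable σ volume →
      IsProductAp p (fun z => σ z ^ p) → productApChar p (fun z => σ z ^ p) ≤ K →
      ∀ f : ProdSpace n m → ℂ, AEStronglyMeasurable f volume →
        (muckenhouptMaximalChar p q ω σ < ∞ →
          eLpNorm (fun z => ‖f z‖ₑ * σ z) (ENNReal.ofReal p) volume < ∞ →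
          ∀ᵐ z, ω z ≠ 0 → Integrable (fun w => strongKernel α β z w • f w) volume) ∧
        eLpNorm (fun z => ω z * ‖strongFractionalIntegral α β f z‖ₑ)
            (ENNReal.ofReal q) volume ≤
          C * muckenhouptMaximalChar p q ω σ *
            eLpNorm (fun z => ‖f z‖ₑ * σ z) (ENNReal.ofReal p) volume := by
  have hp0 : 0 < p := by linarith
  have hq0 : 0 < q := by linarith
  have hn0 : (0 : ℝ) < n := hα.trans hαn
  have hm0 : (0 : ℝ) < m := hβ.trans hβm
  have ha : α = n * (1 / p - 1 / q) := by rw [← hαpq]; field_simp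
  have hb : β = m * (1 / p - 1 / q) := by rw [← hβpq]; field_simp
  obtain ⟨s, hs1, hsp, D, hD, hpt⟩ :=
    exists_ae_mul_lintegral_strongKernel_le (q := q) hαn hβm hp hpq K
  obtain ⟨C, hC, hstrong⟩ := exists_lintegral_strongFracSum_le (n := n) (m := m)
    (by exact_mod_cast hn0) (by exact_mod_cast hm0) hs1.le hsp hpq ha hb
  have hDC : D * C + 1 ≠ ∞ := ENNReal.add_ne_top.2 ⟨ENNReal.mul_ne_top hD hC, by simp⟩
  refine ⟨(D * C + 1).toNNReal, fun ω σ hω hσ hAp hK f hf => ?_⟩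
  rw [ENNReal.coe_toNNReal hDC]
  set A := muckenhouptMaximalChar p q ω σ with hA
  have hφ : AEMeasurable (fun z => ‖f z‖ₑ) volume := hf.enorm
  have hφσ : AEMeasurable (fun z => ‖f z‖ₑ * σ z) volume := hφ.mul hσ
  set g := hφσ.mk _
  have hg : Measurable g := hφσ.measurable_mk
  have hgφ : g =ᵐ[volume] fun z => ‖f z‖ₑ * σ z := hφσ.ae_eq_mk.symm
  have hNg : eLpNorm (fun z => ‖f z‖ₑ * σ z) (ENNReal.ofReal p) volume =
      (∫⁻ z, g z ^ p) ^ (1 / p) := by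
    have h1 : ∫⁻ z, g z ^ p = ∫⁻ z, (‖f z‖ₑ * σ z) ^ p :=
      lintegral_congr_ae (hgφ.fun_comp fun t => t ^ p)
    rw [eLpNorm_ofReal_eq_lintegral hp0, h1]
  have hker : ∀ z, ∫⁻ w, ‖strongKernel α β z w • f w‖ₑ =
      ∫⁻ w, ‖strongKernel α β z w‖ₑ * ‖f w‖ₑ := fun z => by simp_rw [enorm_smul]
  refine ⟨fun hA' hfin => ?_, ?_⟩
  · rw [hNg] at hfin
    have hTfin : ∫⁻ z, strongFracSum α β s g z ^ q ≠ ∞ := by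
      intro h
      have h1 := hstrong g hg
      rw [h, ENNReal.top_rpow_of_pos (by positivity), top_le_iff] at h1
      exact ENNReal.mul_ne_top hC hfin.ne h1
    filter_upwards [hpt ω σ hω hσ hAp hK hA'.ne _ g hφ hg hgφ,
      ae_lt_top ((measurable_strongFracSum α β s hg).pow_const q) hTfin] with z hz hTz hωz
    have hTz' : strongFracSum α β s g z ≠ ∞ := fun h => by
      rw [h, ENNReal.top_rpow_of_pos hq0] at hTz
      exact lt_irrefl _ hTz
    refine ⟨(measurable_strongKernel α β z).aestronglyMeasurable.smul hf, ?_⟩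
    rw [hasFiniteIntegral_iff_enorm, hker, lt_top_iff_ne_top]
    intro h
    rw [h, ENNReal.mul_top hωz, top_le_iff] at hz
    exact ENNReal.mul_ne_top (ENNReal.mul_ne_top hD hA'.ne) hTz' hz
  · rcases eq_or_ne A ∞ with hAtop | hAtop
    · -- an infinite characteristic leaves only the case of a vanishing right-hand factor
      rcases eq_or_ne (eLpNorm (fun z => ‖f z‖ₑ * σ z) (ENNReal.ofReal p) volume) 0 with h0 | h0
      · have hf0 : f =ᵐ[volume] 0 := by
          rw [eLpNorm_eq_zero_iff hφσ.aestronglyMeasurable (by simpa using hp0)] at h0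
          filter_upwards [h0, hAp.ae_pos] with z h1 h2
          rcases mul_eq_zero.1 h1 with h3 | h3
          · simpa using h3
          · rw [h3, ENNReal.zero_rpow_of_pos hp0] at h2
            exact absurd h2 (lt_irrefl _)
        have hI : ∀ z, strongFractionalIntegral α β f z = 0 := fun z => by
          rw [strongFractionalIntegral]
          refine integral_eq_zero_of_ae ?_
          filter_upwards [hf0] with w hw
          simp [hw]
        simp [hI]
      · rw [hAtop, ENNReal.mul_top (by simp), ENNReal.top_mul h0]
        exact le_top
    · rw [hNg, eLpNorm_ofReal_eq_lintegral hq0]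
      calc (∫⁻ z, (ω z * ‖strongFractionalIntegral α β f z‖ₑ) ^ q) ^ (1 / q)
          ≤ (∫⁻ z, (D * A * strongFracSum α β s g z) ^ q) ^ (1 / q) := by
            refine ENNReal.rpow_le_rpow (lintegral_mono_ae ?_) (by positivity)
            filter_upwards [hpt ω σ hω hσ hAp hK hAtop _ g hφ hg hgφ] with z hz
            refine ENNReal.rpow_le_rpow (le_trans ?_ hz) hq0.le
            rw [← hker]
            gcongr
            exact enorm_integral_le_lintegral_enorm _
        _ = D * A * (∫⁻ z, strongFracSum α β s g z ^ q) ^ (1 / q) := by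
            simp_rw [ENNReal.mul_rpow_of_nonneg _ _ hq0.le]
            rw [lintegral_const_mul _ ((measurable_strongFracSum α β s hg).pow_const q),
              ← ENNReal.mul_rpow_of_nonneg _ _ hq0.le,
              ENNReal.mul_rpow_of_nonneg _ _ (by positivity), ← ENNReal.rpow_mul,
              mul_one_div_cancel hq0.ne', ENNReal.rpow_one]
        _ ≤ D * A * (C * (∫⁻ z, g z ^ p) ^ (1 / p)) := mul_le_mul_right (hstrong g hg) _
        _ = D * C * A * (∫⁻ z, g z ^ p) ^ (1 / p) := by ring
        _ ≤ _ := by gcongr; exact le_self_add
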